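/- **Setting.** Everything is stated both in discrete time and in continuous time. Rational matrices have complex coefficients; poles and zeros are taken on the Riemann sphere $\mathbb C\cup\{\infty\}$. In discrete time the open stability region is $\{|z|<1\}$, its boundary is $\{|z|=1\}$, and $W(z)^*:=\overline{W(1/\bar z)}^{\,\top}$. In continuous time the open stability region is $\{\operatorname{Re}s<0\}$, its boundary is $\{\operatorname{Re}s=0\}\cup\{\infty\}$, and $W(s)^*:=\overline{W(-\bar s)}^{\,\top}$. A rational matrix is *stable* if all its poles lie in the open stability region (in particular it is proper). A point $\alpha$ that is not a pole of $W$ is a *zero* of $W$ if $W(\alpha)v=0$ for some vector $v\neq0$. $W$ is *minimum-phase* if it is stable and all its zeros lie in the closed stability region (the open region together with its boundary). A square rational matrix $Q$ is *inner* if it is stable and $Q^*Q=I$. A *right-coprime factorization* $T=ND^{-1}$ consists of stable rational matrices $N,D$ with $\det D\not\equiv0$ and such that $XD+YN=I$ for some stable rational matrices $X,Y$. A *rational spectral density* is a square rational matrix that has no poles on the boundary and is Hermitian positive semidefinite there; $W$ is a *spectral factor* of $\Phi$ if $\Phi=WW^*$. **Lemma 3.1.** Let $m>0$, $p\ge0$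 be integers and let $$\Phi=\begin{bmatrix}\Phi_{11}&\Phi_{12}\\ \Phi_{21}&\Phi_{22}\end{bmatrix}$$ be an $(m+p)\times(m+p)$ rational spectral density of (normal) rank $m$ whose $m\times m$ block $\Phi_{11}$ has full rank $m$. Put $H=\Phi_{21}\Phi_{11}^{-1}$ and let $G_1$ be an $m\times m$ minimum-phase spectral factor of $\Phi_{11}$. Then: 1. There is a right-coprime factorization $HG_1=W_2Q_1^{-1}$ whose denominator $Q_1$ is inner. If $\Phi$ and $G_1$ have real coefficients, then $W_2$ and $Q_1$ can be chosen with real coefficients. 2. For every right-coprime factorization $HG_1=W_2Q_1^{-1}$ with $Q_1$ inner, put $W_1=G_1Q_1$. Then $W_1$ has full rank $m$, and $$W=\begin{bmatrix}W_1\\W_2\end{bmatrix}$$ is a minimum-phase spectral factor of $\Phi$ of full column rank $m$. -/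

import Mathlib

open scoped ComplexOrder

noncomputable section

namespace SpecFact

/-! ### Scalar rational functions on the Riemann sphere `ℂ ∪ {∞}` -/

/-- The rational function `f` has a pole at a point of the Riemann sphere. (Mathlib's `num` and
`denom` are coprime; at `∞`, a pole means that `f` is not proper.) -/
def HasPole (f : RatFunc ℂ) (α : OnePoint ℂ) : Prop :=
  α.elim (0 < f.intDegree) (fun z => f.denom.IsRoot z)

/-- The value of `f` at a point of the Riemann sphere that is not a pole of `f`. At `∞` this is the
ratio of the coefficients of degree `deg (denom f)` (the polynomial `denom f` is monic). -/
def valueAt (f : RatFunc ℂ) (α : OnePoint ℂ) : ℂ :=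
  α.elim (f.num.coeff f.denom.natDegree) (fun z => f.eval (RingHom.id ℂ) z)

/-- `f` has real coefficients. -/
def IsReal (f : RatFunc ℂ) : Prop :=
  ∀ k, (f.num.coeff k).im = 0 ∧ (f.denom.coeff k).im = 0

/-! ### The two settings -/

/-- Discrete time (unit disc) or continuous time (left half plane). -/
inductive TimeDomain where
  | discrete
  | continuous

/-- The open stability region: the open unit disc, or the open left half plane. -/
def TimeDomain.stableRegion : TimeDomain → Set (OnePoint ℂ)
  | .discrete => {α | ∃ z : ℂ, α = z ∧ ‖z‖ < 1}
  | .continuous => {α | ∃ s : ℂ, α = s ∧ s.re < 0}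

/-- The boundary of the stability region on the Riemann sphere: the unit circle, or the imaginary
axis together with `∞`. -/
def TimeDomain.boundary : TimeDomain → Set (OnePoint ℂ)
  | .discrete => {α | ∃ z : ℂ, α = z ∧ ‖z‖ = 1}
  | .continuous => {α | α = OnePoint.infty ∨ ∃ s : ℂ, α = s ∧ s.re = 0}

/-- The closed stability region (on the Riemann sphere). -/
def TimeDomain.closedStableRegion (τ : TimeDomain) : Set (OnePoint ℂ) :=
  τ.stableRegion ∪ τ.boundary

/-- The substitution in the para-Hermitian conjugate: `z ↦ z⁻¹`, or `s ↦ -s`. -/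
def TimeDomain.reflection : TimeDomain → RatFunc ℂ
  | .discrete => RatFunc.X⁻¹
  | .continuous => -RatFunc.X

/-- The conjugate `f^*` of a rational function: conjugate the coefficients and substitute `z⁻¹`
for `z` (resp. `-s` for `s`), so that `f^*(z) = conj (f (1 / conj z))`, resp.
`f^*(s) = conj (f (-conj s))`. -/
def paraConj (τ : TimeDomain) (f : RatFunc ℂ) : RatFunc ℂ :=
  f.eval (RatFunc.C.comp (starRingEnd ℂ)) τ.reflection

/-! ### Rational matrices -/

section Matrices

variable {ι κ : Type*}

/-- The conjugate transpose `W^*` of a rational matrix `W`; it agrees with the pointwise conjugate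
transpose on the unit circle (resp. the imaginary axis). -/
def paraConjTranspose (τ : TimeDomain) (W : Matrix ι κ (RatFunc ℂ)) : Matrix κ ι (RatFunc ℂ) :=
  (W.map (paraConj τ)).transpose

/-- `α` is a pole of `W` if it is a pole of some entry. -/
def IsPoleOf (W : Matrix ι κ (RatFunc ℂ)) (α : OnePoint ℂ) : Prop :=
  ∃ i j, HasPole (W i j) α

/-- The complex matrix `W(α)`, for `α` not a pole of `W`. -/
def matrixValueAt (W : Matrix ι κ (RatFunc ℂ)) (α : OnePoint ℂ) : Matrix ι κ ℂ :=
  W.map (fun f => valueAt f α)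

/-- `α` is a (right) zero of `W`: `W` is analytic at `α` and `W(α) v = 0` for some `v ≠ 0`. -/
def IsZeroOf [Fintype κ] (W : Matrix ι κ (RatFunc ℂ)) (α : OnePoint ℂ) : Prop :=
  ¬ IsPoleOf W α ∧ ∃ v : κ → ℂ, v ≠ 0 ∧ (matrixValueAt W α).mulVec v = 0

/-- `W` is stable (belongs to the rational `H^∞`): all its poles on the Riemann sphere lie in the
open stability region. -/
def IsStable (τ : TimeDomain) (W : Matrix ι κ (RatFunc ℂ)) : Prop :=
  ∀ α, IsPoleOf W α → α ∈ τ.stableRegion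

/-- `W` is minimum-phase: all its poles lie in the open stability region and all its zeros in the
closed stability region. -/
def IsMinimumPhase [Fintype κ] (τ : TimeDomain) (W : Matrix ι κ (RatFunc ℂ)) : Prop :=
  IsStable τ W ∧ ∀ α, IsZeroOf W α → α ∈ τ.closedStableRegion

/-- A square rational matrix is inner: stable, and unitary on the boundary. -/
def IsInner [Fintype κ] [DecidableEq κ] (τ : TimeDomain) (Q : Matrix κ κ (RatFunc ℂ)) : Prop :=
  IsStable τ Q ∧ paraConjTranspose τ Q * Q = 1

/-- A rational spectral density: no poles on the boundary, and Hermitian positive semidefinite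
there. -/
def IsSpectralDensity [Fintype ι] (τ : TimeDomain) (Φ : Matrix ι ι (RatFunc ℂ)) : Prop :=
  ∀ α ∈ τ.boundary, ¬ IsPoleOf Φ α ∧ (matrixValueAt Φ α).PosSemidef

/-- `W` is a spectral factor of `Φ`. -/
def IsSpectralFactor [Fintype κ] (τ : TimeDomain) (Φ : Matrix ι ι (RatFunc ℂ))
    (W : Matrix ι κ (RatFunc ℂ)) : Prop :=
  Φ = W * paraConjTranspose τ W

/-- `T = N * D⁻¹` is a right-coprime factorization of `T` over the ring of stable rational
functions (coprimeness is the Bezout identity over that ring). -/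
structure IsRightCoprimeFactorization [Fintype ι] [Fintype κ] [DecidableEq κ] (τ : TimeDomain)
    (T N : Matrix ι κ (RatFunc ℂ)) (D : Matrix κ κ (RatFunc ℂ)) : Prop where
  stable_num : IsStable τ N
  stable_denom : IsStable τ D
  det_ne_zero : D.det ≠ 0
  eq_mul_inv : T = N * D⁻¹
  bezout : ∃ (X : Matrix κ κ (RatFunc ℂ)) (Y : Matrix κ ι (RatFunc ℂ)),
    IsStable τ X ∧ IsStable τ Y ∧ X * D + Y * N = 1

/-- All entries of `W` have real coefficients. -/
def IsRealMatrix (W : Matrix ι κ (RatFunc ℂ)) : Prop :=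
  ∀ i j, IsReal (W i j)

end Matrices

end SpecFact

end

/-! Put `T = H * G₁`. Since `Φ` and `Φ₁₁` both have rank `m`, the Schur complement of `Φ₁₁` vanishes
(`toBlocks₂₂_eq_of_rank`), so `Φ₂₂ = T T^*`. On the boundary a diagonal entry of `T T^*` is a sum of
squared moduli, in which poles cannot cancel. As `Φ` has no boundary poles, neither has `T`
(`exists_value_of_mul_paraConjTranspose`).

Existence of the factorization is proved in a coordinate (`chart`) that turns the complement of the
stability region into the closed unit disc. The poles of `T` in the open disc are cleared by a
scalar Blaschke product `b`, so `D = b • 1` is a first inner denominator. A common zero of `D` and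
`T D` in a direction `v` is divided out by a Blaschke–Potapov factor, which removes one zero of `det
D`; hence the process stops (`exists_inner_denom_without_common_zero`). Then `D` stacked on `T D`
has injective values on the closed disc, and its stable left inverse is a Bezout pair
(`exists_isDiscStable_leftInverse`). For real `T`, `D` and its coefficient conjugate differ by a
constant unitary factor; normalizing `D(1) = 1` makes this factor trivial.

For any such factorization, `W` is `G₁` stacked on `T`, times `Q₁`; since `Q₁ Q₁^* = 1`, this gives
`W W^* = Φ`. If `W(α) v = 0` with `α` outside the closed stability region, the minimum-phase
property of `G₁` gives `Q₁(α) v = 0`. Also `W₂(α) v = 0`, and the Bezout identity forces `v = 0`. -/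

noncomputable section

namespace SpecFact

open Polynomial

/-! ### Values of rational functions on the Riemann sphere -/

/-- The value at `z` of a polynomial, or its coefficient of degree `n` at `∞`. -/
def leadAt (α : OnePoint ℂ) (n : ℕ) (p : ℂ[X]) : ℂ :=
  α.elim (p.coeff n) (fun z => p.eval z)

/-- The rational function `f` is analytic at `α`, with value `c`. -/
def TakesValue (f : RatFunc ℂ) (α : OnePoint ℂ) (c : ℂ) : Prop :=
  ∃ (n : ℕ) (p q : ℂ[X]), p.natDegree ≤ n ∧ q.natDegree ≤ n ∧ leadAt α n q ≠ 0 ∧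
    f = algebraMap ℂ[X] (RatFunc ℂ) p / algebraMap ℂ[X] (RatFunc ℂ) q ∧
    c = leadAt α n p / leadAt α n q

theorem leadAt_add (α : OnePoint ℂ) (n : ℕ) (p q : ℂ[X]) :
    leadAt α n (p + q) = leadAt α n p + leadAt α n q := by
  induction α using OnePoint.rec <;> simp [leadAt]

theorem leadAt_zero (α : OnePoint ℂ) (n : ℕ) : leadAt α n 0 = 0 := by
  induction α using OnePoint.rec <;> simp [leadAt]

/-- At `∞` the leading coefficient is taken in a formal degree, and formal degrees add. This is what
lets finite points and `∞` share one calculus of values. -/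
theorem leadAt_mul (α : OnePoint ℂ) {n k : ℕ} {p q : ℂ[X]} (hp : p.natDegree ≤ n)
    (hq : q.natDegree ≤ k) : leadAt α (n + k) (p * q) = leadAt α n p * leadAt α k q := by
  induction α using OnePoint.rec with
  | infty => simpa [leadAt] using coeff_mul_add_eq_of_natDegree_le hp hq
  | coe z => simp [leadAt]

theorem ne_zero_of_leadAt {α : OnePoint ℂ} {n : ℕ} {p : ℂ[X]} (h : leadAt α n p ≠ 0) : p ≠ 0 := by
  rintro rfl
  exact h (leadAt_zero α n)

theorem TakesValue.add {f g : RatFunc ℂ} {α : OnePoint ℂ} {c d : ℂ} (hf : TakesValue f α c)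
    (hg : TakesValue g α d) : TakesValue (f + g) α (c + d) := by
  obtain ⟨n, p, q, hp, hq, h0, rfl, rfl⟩ := hf
  obtain ⟨k, r, s, hr, hs, h1, rfl, rfl⟩ := hg
  have hq0 := RatFunc.algebraMap_ne_zero (ne_zero_of_leadAt h0)
  have hs0 := RatFunc.algebraMap_ne_zero (ne_zero_of_leadAt h1)
  refine ⟨n + k, p * s + q * r, q * s, ?_, ?_, ?_, ?_, ?_⟩
  · exact (natDegree_add_le _ _).trans (max_le (natDegree_mul_le.trans (by omega))
      (natDegree_mul_le.trans (by omega)))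
  · exact natDegree_mul_le.trans (by omega)
  · rw [leadAt_mul α hq hs]
    exact mul_ne_zero h0 h1
  · rw [div_add_div _ _ hq0 hs0]
    simp
  · rw [leadAt_add, leadAt_mul α hq hs, leadAt_mul α hp hs, leadAt_mul α hq hr,
      div_add_div _ _ h0 h1]

theorem TakesValue.mul {f g : RatFunc ℂ} {α : OnePoint ℂ} {c d : ℂ} (hf : TakesValue f α c)
    (hg : TakesValue g α d) : TakesValue (f * g) α (c * d) := by
  obtain ⟨n, p, q, hp, hq, h0, rfl, rfl⟩ := hf
  obtain ⟨k, r, s, hr, hs, h1, rfl, rfl⟩ := hg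
  refine ⟨n + k, p * r, q * s, natDegree_mul_le.trans (by omega), natDegree_mul_le.trans (by omega),
    ?_, ?_, ?_⟩
  · rw [leadAt_mul α hq hs]
    exact mul_ne_zero h0 h1
  · rw [div_mul_div_comm]
    simp
  · rw [leadAt_mul α hq hs, leadAt_mul α hp hr, div_mul_div_comm]

theorem TakesValue.inv {f : RatFunc ℂ} {α : OnePoint ℂ} {c : ℂ} (hf : TakesValue f α c)
    (hc : c ≠ 0) : TakesValue f⁻¹ α c⁻¹ := by
  obtain ⟨n, p, q, hp, hq, h0, rfl, rfl⟩ := hf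
  refine ⟨n, q, p, hq, hp, fun h => hc (by simp [h]), by simp, by simp⟩

theorem takesValue_C (a : ℂ) (α : OnePoint ℂ) : TakesValue (RatFunc.C a) α a := by
  refine ⟨0, Polynomial.C a, 1, by simp, by simp, ?_, by simp, ?_⟩ <;>
  induction α using OnePoint.rec <;> simp [leadAt]

theorem takesValue_zero (α : OnePoint ℂ) : TakesValue 0 α 0 := by
  simpa using takesValue_C 0 α

theorem takesValue_one (α : OnePoint ℂ) : TakesValue 1 α 1 := by
  simpa using takesValue_C 1 α

theorem takesValue_algebraMap (p : ℂ[X]) (z : ℂ) :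
    TakesValue (algebraMap ℂ[X] (RatFunc ℂ) p) z (p.eval z) := by
  refine ⟨p.natDegree, p, 1, le_rfl, by simp, by simp [leadAt], by simp, by simp [leadAt]⟩

theorem takesValue_X (z : ℂ) : TakesValue RatFunc.X z z := by
  simpa using takesValue_algebraMap Polynomial.X z

theorem takesValue_X_inv_infty : TakesValue (RatFunc.X⁻¹) OnePoint.infty 0 :=
  ⟨1, 1, Polynomial.X, by simp, by simp, by simp [leadAt], by simp, by simp [leadAt, coeff_one]⟩

theorem TakesValue.neg {f : RatFunc ℂ} {α : OnePoint ℂ} {c : ℂ} (hf : TakesValue f α c) :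
    TakesValue (-f) α (-c) := by
  simpa using (takesValue_C (-1) α).mul hf

theorem TakesValue.sub {f g : RatFunc ℂ} {α : OnePoint ℂ} {c d : ℂ} (hf : TakesValue f α c)
    (hg : TakesValue g α d) : TakesValue (f - g) α (c - d) := by
  simpa [sub_eq_add_neg] using hf.add hg.neg

theorem TakesValue.div {f g : RatFunc ℂ} {α : OnePoint ℂ} {c d : ℂ} (hf : TakesValue f α c)
    (hg : TakesValue g α d) (hd : d ≠ 0) : TakesValue (f / g) α (c / d) := by
  simpa [div_eq_mul_inv] using hf.mul (hg.inv hd)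

theorem TakesValue.sum {ι : Type*} {s : Finset ι} {f : ι → RatFunc ℂ} {α : OnePoint ℂ} {c : ι → ℂ}
    (h : ∀ i ∈ s, TakesValue (f i) α (c i)) : TakesValue (∑ i ∈ s, f i) α (∑ i ∈ s, c i) := by
  classical
  induction s using Finset.induction_on with
  | empty => simpa using takesValue_zero α
  | insert a s ha ih =>
    rw [Finset.sum_insert ha, Finset.sum_insert ha]
    exact (h a (by simp)).add (ih fun i hi => h i (by simp [hi]))

theorem TakesValue.prod {ι : Type*} {s : Finset ι} {f : ι → RatFunc ℂ} {α : OnePoint ℂ} {c : ι → ℂ}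
    (h : ∀ i ∈ s, TakesValue (f i) α (c i)) : TakesValue (∏ i ∈ s, f i) α (∏ i ∈ s, c i) := by
  classical
  induction s using Finset.induction_on with
  | empty => simpa using takesValue_one α
  | insert a s ha ih =>
    rw [Finset.prod_insert ha, Finset.prod_insert ha]
    exact (h a (by simp)).mul (ih fun i hi => h i (by simp [hi]))

theorem TakesValue.eval₂ {t : RatFunc ℂ} {α : OnePoint ℂ} {c : ℂ} (ht : TakesValue t α c)
    (σ : ℂ →+* ℂ) (p : ℂ[X]) :
    TakesValue (p.eval₂ (RatFunc.C.comp σ) t) α (p.eval₂ σ c) := by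
  induction p using Polynomial.induction_on' with
  | add p q hp hq => simpa using hp.add hq
  | monomial n a =>
    have h := (takesValue_C (σ a) α).mul (TakesValue.prod (s := Finset.range n) fun i _ => ht)
    simpa [eval₂_monomial] using h

theorem TakesValue.unique {f : RatFunc ℂ} {α : OnePoint ℂ} {c d : ℂ} (hc : TakesValue f α c)
    (hd : TakesValue f α d) : c = d := by
  obtain ⟨n, p, q, hp, hq, h0, rfl, rfl⟩ := hc
  obtain ⟨k, r, s, hr, hs, h1, h, rfl⟩ := hd
  have hq0 := RatFunc.algebraMap_ne_zero (ne_zero_of_leadAt h0)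
  have hs0 := RatFunc.algebraMap_ne_zero (ne_zero_of_leadAt h1)
  rw [div_eq_div_iff hq0 hs0, ← map_mul, ← map_mul] at h
  have h2 := RatFunc.algebraMap_injective ℂ h
  rw [div_eq_div_iff h0 h1, ← leadAt_mul α hp hs, h2, ← leadAt_mul α hr hq, add_comm n k]

theorem takesValue_valueAt {f : RatFunc ℂ} {α : OnePoint ℂ} (h : ¬ HasPole f α) :
    TakesValue f α (valueAt f α) := by
  induction α using OnePoint.rec with
  | infty =>
    have h' : f.num.natDegree ≤ f.denom.natDegree := by
      simpa [HasPole, RatFunc.intDegree] using h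
    refine ⟨f.denom.natDegree, f.num, f.denom, h', le_rfl, ?_, (RatFunc.num_div_denom f).symm, ?_⟩
    · simp [leadAt, f.monic_denom.leadingCoeff]
    · simp [leadAt, valueAt, f.monic_denom.leadingCoeff]
  | coe z =>
    have h' : f.denom.eval z ≠ 0 := by simpa [HasPole] using h
    exact ⟨max f.num.natDegree f.denom.natDegree, f.num, f.denom, le_max_left _ _, le_max_right _ _,
      h', (RatFunc.num_div_denom f).symm, rfl⟩

theorem TakesValue.not_hasPole {f : RatFunc ℂ} {α : OnePoint ℂ} {c : ℂ} (h : TakesValue f α c) :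
    ¬ HasPole f α := by
  obtain ⟨n, p, q, hp, hq, h0, rfl, -⟩ := h
  have hq0 := ne_zero_of_leadAt h0
  induction α using OnePoint.rec with
  | infty =>
    have hqn : q.natDegree = n := natDegree_eq_of_le_of_coeff_ne_zero hq h0
    simp only [HasPole, OnePoint.elim_infty, not_lt]
    by_cases hp0 : p = 0
    · simp [hp0]
    · rw [RatFunc.intDegree_div (RatFunc.algebraMap_ne_zero hp0) (RatFunc.algebraMap_ne_zero hq0)]
      simp
      omega
  | coe z =>
    intro h
    exact h0 (h.dvd (RatFunc.denom_div_dvd p q))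

/-- The rational functions that are analytic at `α` form a valuation ring. -/
theorem exists_takesValue_or_inv (f : RatFunc ℂ) (α : OnePoint ℂ) :
    (∃ c, TakesValue f α c) ∨ TakesValue f⁻¹ α 0 := by
  by_cases h : HasPole f α
  · right
    induction α using OnePoint.rec with
    | infty =>
      have h' : f.denom.natDegree < f.num.natDegree := by
        simpa [HasPole, RatFunc.intDegree] using h
      have hf : f.num ≠ 0 := by
        intro h0
        simp [h0] at h'
      refine ⟨f.num.natDegree, f.denom, f.num, h'.le, le_rfl, ?_, ?_, ?_⟩
      · simpa [leadAt] using hf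
      · rw [← inv_div, RatFunc.num_div_denom]
      · simp [leadAt, coeff_eq_zero_of_natDegree_lt h']
    | coe z =>
      have h' : f.denom.eval z = 0 := h
      refine ⟨max f.denom.natDegree f.num.natDegree, f.denom, f.num, le_max_left _ _,
        le_max_right _ _, ?_, ?_, ?_⟩
      · obtain ⟨a, b, hab⟩ := f.isCoprime_num_denom
        intro h0
        have h1 : f.num.eval z = 0 := h0
        have := congrArg (Polynomial.eval z) hab
        simp [h1, h'] at this
      · rw [← inv_div, RatFunc.num_div_denom]
      · simp [leadAt, h']
  · exact Or.inl ⟨_, takesValue_valueAt h⟩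

theorem mul_denom_eq_num (f : RatFunc ℂ) :
    f * algebraMap ℂ[X] (RatFunc ℂ) f.denom = algebraMap ℂ[X] (RatFunc ℂ) f.num :=
  ((div_eq_iff (RatFunc.algebraMap_ne_zero f.denom_ne_zero)).1 (RatFunc.num_div_denom f)).symm

/-- A rational function with infinitely many zeros vanishes. -/
theorem eq_zero_of_infinite {f : RatFunc ℂ} {s : Set ℂ} (hs : s.Infinite)
    (h : ∀ z ∈ s, TakesValue f z 0) : f = 0 := by
  rw [← RatFunc.num_eq_zero_iff]
  refine Polynomial.eq_zero_of_infinite_isRoot _ (hs.mono fun z hz => ?_)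
  have hf := (h z hz).mul (takesValue_algebraMap f.denom z)
  rw [mul_denom_eq_num, zero_mul] at hf
  exact (takesValue_algebraMap f.num z).unique hf

/-! ### Substitutions -/

/-- A rational function with infinitely many values is transcendental over the constants. -/
theorem transcendental_of_infinite {t : RatFunc ℂ}
    (h : {c : ℂ | ∃ α, TakesValue t α c}.Infinite) : Transcendental ℂ t := by
  rw [transcendental_iff]
  intro p hp
  refine Polynomial.eq_zero_of_infinite_isRoot _ (h.mono ?_)
  rintro c ⟨α, hc⟩
  have h1 := hc.eval₂ (RingHom.id ℂ) p
  have h2 : p.eval₂ (RatFunc.C.comp (RingHom.id ℂ)) t = 0 := hp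
  rw [h2] at h1
  exact h1.unique (takesValue_zero α)

theorem nonZeroDivisors_le_comap_eval₂ (σ : ℂ →+* ℂ) {t : RatFunc ℂ} (ht : Transcendental ℂ t) :
    nonZeroDivisors ℂ[X] ≤
      (nonZeroDivisors (RatFunc ℂ)).comap (eval₂RingHom (RatFunc.C.comp σ) t) := by
  intro p hp
  rw [Submonoid.mem_comap, mem_nonZeroDivisors_iff_ne_zero]
  intro h
  refine nonZeroDivisors.ne_zero hp ?_
  have h1 : aeval t (p.map σ) = 0 := by
    rw [aeval_def, eval₂_map]
    exact h
  exact (Polynomial.map_eq_zero_iff σ.injective).1 (transcendental_iff.1 ht _ h1)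

/-- Apply `σ` to the coefficients and substitute `t` for the variable. -/
def substHom (σ : ℂ →+* ℂ) (t : RatFunc ℂ) (ht : Transcendental ℂ t) : RatFunc ℂ →+* RatFunc ℂ :=
  RatFunc.liftRingHom (eval₂RingHom (RatFunc.C.comp σ) t) (nonZeroDivisors_le_comap_eval₂ σ ht)

theorem substHom_apply (σ : ℂ →+* ℂ) {t : RatFunc ℂ} (ht : Transcendental ℂ t) (f : RatFunc ℂ) :
    substHom σ t ht f = f.eval (RatFunc.C.comp σ) t :=
  RatFunc.liftRingHom_apply _ _ _

@[simp]
theorem substHom_C (σ : ℂ →+* ℂ) {t : RatFunc ℂ} (ht : Transcendental ℂ t) (c : ℂ) :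
    substHom σ t ht (RatFunc.C c) = RatFunc.C (σ c) := by
  simp [substHom]

@[simp]
theorem substHom_X (σ : ℂ →+* ℂ) {t : RatFunc ℂ} (ht : Transcendental ℂ t) :
    substHom σ t ht RatFunc.X = t := by
  simp [substHom]

/-- The identities between conjugations and charts all reduce to a check on constants and on `X`. -/
theorem ratFunc_hom_ext {φ ψ : RatFunc ℂ →+* RatFunc ℂ}
    (hC : ∀ c, φ (RatFunc.C c) = ψ (RatFunc.C c)) (hX : φ RatFunc.X = ψ RatFunc.X) : φ = ψ := by
  refine IsLocalization.ringHom_ext (nonZeroDivisors ℂ[X]) (Polynomial.ringHom_ext ?_ ?_)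
  · intro c
    simpa using hC c
  · simpa using hX

theorem TakesValue.substHom {f : RatFunc ℂ} {w c : ℂ} (hf : TakesValue f w c) {α : OnePoint ℂ}
    {σ : ℂ →+* ℂ} {t : RatFunc ℂ} (ht : Transcendental ℂ t) (hw : TakesValue t α (σ w)) :
    TakesValue (substHom σ t ht f) α (σ c) := by
  obtain ⟨n, p, q, -, -, h0, rfl, rfl⟩ := hf
  have key : ∀ r : ℂ[X], TakesValue (SpecFact.substHom σ t ht (algebraMap ℂ[X] (RatFunc ℂ) r)) α
      (σ (r.eval w)) := by
    intro r
    have := hw.eval₂ σ r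
    rw [eval₂_at_apply] at this
    simpa [SpecFact.substHom, RatFunc.liftRingHom_algebraMap] using this
  rw [map_div₀, map_div₀]
  exact (key p).div (key q) (by simpa using h0)

/-! ### Conjugation -/

theorem transcendental_of_takesValue {t : RatFunc ℂ} {s : Set ℂ} (hs : s.Infinite) {v : ℂ → ℂ}
    (hv : Set.InjOn v s) (h : ∀ z ∈ s, TakesValue t z (v z)) : Transcendental ℂ t := by
  refine transcendental_of_infinite ((hs.image hv).mono ?_)
  rintro _ ⟨z, hz, rfl⟩
  exact ⟨z, h z hz⟩

theorem infinite_compl_singleton (a : ℂ) : ({a}ᶜ : Set ℂ).Infinite :=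
  (Set.finite_singleton a).infinite_compl

theorem transcendental_X_inv : Transcendental ℂ (RatFunc.X⁻¹ : RatFunc ℂ) :=
  transcendental_of_takesValue (infinite_compl_singleton 0) (v := fun z => z⁻¹)
    (fun _ _ _ _ h => inv_injective h) fun z hz => (takesValue_X z).inv hz

theorem transcendental_reflection (τ : TimeDomain) : Transcendental ℂ τ.reflection := by
  cases τ with
  | discrete => exact transcendental_X_inv
  | continuous =>
    exact transcendental_of_takesValue (infinite_compl_singleton 0) (v := fun z => -z)
      (fun _ _ _ _ h => neg_injective h) fun z _ => (takesValue_X z).neg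

/-- The conjugation `f ↦ f^*` as a ring homomorphism. -/
def paraConjHom (τ : TimeDomain) : RatFunc ℂ →+* RatFunc ℂ :=
  substHom (starRingEnd ℂ) τ.reflection (transcendental_reflection τ)

theorem paraConjHom_apply (τ : TimeDomain) (f : RatFunc ℂ) : paraConjHom τ f = paraConj τ f :=
  substHom_apply _ _ _

@[simp]
theorem paraConjHom_C (τ : TimeDomain) (c : ℂ) :
    paraConjHom τ (RatFunc.C c) = RatFunc.C (starRingEnd ℂ c) := by
  simp [paraConjHom]

@[simp]
theorem paraConjHom_X (τ : TimeDomain) : paraConjHom τ RatFunc.X = τ.reflection := by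
  simp [paraConjHom]

@[simp]
theorem paraConjHom_paraConjHom (τ : TimeDomain) (f : RatFunc ℂ) :
    paraConjHom τ (paraConjHom τ f) = f := by
  have : (paraConjHom τ).comp (paraConjHom τ) = RingHom.id _ := by
    refine ratFunc_hom_ext (by simp) ?_
    cases τ <;> simp [TimeDomain.reflection]
  exact congrArg (fun φ => φ f) this

/-- Complex conjugation of the coefficients. -/
def coeffConj : RatFunc ℂ →+* RatFunc ℂ :=
  substHom (starRingEnd ℂ) RatFunc.X RatFunc.transcendental_X

@[simp]
theorem coeffConj_C (c : ℂ) : coeffConj (RatFunc.C c) = RatFunc.C (starRingEnd ℂ c) := by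
  simp [coeffConj]

@[simp]
theorem coeffConj_X : coeffConj RatFunc.X = RatFunc.X := by
  simp [coeffConj]

theorem coeffConj_algebraMap (p : ℂ[X]) :
    coeffConj (algebraMap ℂ[X] (RatFunc ℂ) p) =
      algebraMap ℂ[X] (RatFunc ℂ) (p.map (starRingEnd ℂ)) := by
  induction p using Polynomial.induction_on' with
  | add p q hp hq => simp [hp, hq]
  | monomial n a => simp

theorem map_conj_eq_self_iff (p : ℂ[X]) :
    p.map (starRingEnd ℂ) = p ↔ ∀ k, (p.coeff k).im = 0 := by
  simp [Polynomial.ext_iff, Complex.conj_eq_iff_im]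

/-- Conjugation preserves degree and monicity. If `f` is invariant, its reduced denominator divides
the conjugated one, so the two monic polynomials of equal degree agree; the numerators then agree as
well. -/
theorem isReal_iff (f : RatFunc ℂ) : IsReal f ↔ coeffConj f = f := by
  have h0 := RatFunc.algebraMap_ne_zero f.denom_ne_zero
  have e : coeffConj f = algebraMap ℂ[X] (RatFunc ℂ) (f.num.map (starRingEnd ℂ)) /
      algebraMap ℂ[X] (RatFunc ℂ) (f.denom.map (starRingEnd ℂ)) := by
    conv_lhs => rw [← RatFunc.num_div_denom f]
    rw [map_div₀, coeffConj_algebraMap, coeffConj_algebraMap]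
  simp only [IsReal, forall_and, ← map_conj_eq_self_iff]
  constructor
  · rintro ⟨h1, h2⟩
    rw [e, h1, h2, RatFunc.num_div_denom]
  · intro h
    have hm : (f.denom.map (starRingEnd ℂ)).Monic := f.monic_denom.map _
    have hd : f.denom ∣ f.denom.map (starRingEnd ℂ) := by
      have := RatFunc.denom_div_dvd (f.num.map (starRingEnd ℂ)) (f.denom.map (starRingEnd ℂ))
      rwa [← e, h] at this
    have h2 : f.denom.map (starRingEnd ℂ) = f.denom :=
      (Polynomial.eq_of_monic_of_dvd_of_natDegree_le f.monic_denom hm hd (by simp))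
    refine ⟨?_, h2⟩
    rw [h2] at e
    refine RatFunc.algebraMap_injective ℂ ?_
    rw [← div_left_inj' h0, ← e, RatFunc.num_div_denom, h]

/-! ### The disc charts -/

/-- The coordinate in which the complement of the stability region is the closed unit disc. -/
def TimeDomain.coord : TimeDomain → RatFunc ℂ
  | .discrete => RatFunc.X⁻¹
  | .continuous => (RatFunc.X - 1) / (RatFunc.X + 1)

/-- The point with a given coordinate. -/
def TimeDomain.point (τ : TimeDomain) (w : ℂ) : OnePoint ℂ := by
  classical
  exact match τ with
  | .discrete => if w = 0 then OnePoint.infty else ((w⁻¹ : ℂ) : OnePoint ℂ)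
  | .continuous => if w = 1 then OnePoint.infty else (((1 + w) / (1 - w) : ℂ) : OnePoint ℂ)

theorem takesValue_coord (τ : TimeDomain) (w : ℂ) : TakesValue τ.coord (τ.point w) w := by
  cases τ with
  | discrete =>
    by_cases hw : w = 0
    · simpa [TimeDomain.coord, TimeDomain.point, hw] using takesValue_X_inv_infty
    · simpa [TimeDomain.coord, TimeDomain.point, hw] using (takesValue_X w⁻¹).inv (inv_ne_zero hw)
  | continuous =>
    by_cases hw : w = 1
    · subst hw
      simp only [TimeDomain.coord, TimeDomain.point, if_true]
      exact ⟨1, Polynomial.X - 1, Polynomial.X + 1, by compute_degree, by compute_degree,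
        by simp [leadAt, coeff_one], by simp, by simp [leadAt, coeff_one]⟩
    · have hw' : 1 - w ≠ 0 := sub_ne_zero.2 (Ne.symm hw)
      simp only [TimeDomain.coord, TimeDomain.point, if_neg hw]
      have h := ((takesValue_X ((1 + w) / (1 - w))).sub (takesValue_one _)).div
        ((takesValue_X ((1 + w) / (1 - w))).add (takesValue_one _)) (by
          rw [div_add_one hw']
          ring_nf
          simpa [sub_eq_add_neg] using hw')
      convert h using 1
      field_simp
      ring

theorem transcendental_coord (τ : TimeDomain) : Transcendental ℂ τ.coord :=
  transcendental_of_infinite (Set.infinite_univ.mono fun w _ => ⟨_, takesValue_coord τ w⟩)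

/-- Substitution of the coordinate: from the disc model to the given time domain. -/
def chart (τ : TimeDomain) : RatFunc ℂ →+* RatFunc ℂ :=
  substHom (RingHom.id ℂ) τ.coord (transcendental_coord τ)

@[simp]
theorem chart_C (τ : TimeDomain) (c : ℂ) : chart τ (RatFunc.C c) = RatFunc.C c := by
  simp [chart]

@[simp]
theorem chart_X (τ : TimeDomain) : chart τ RatFunc.X = τ.coord := by
  simp [chart]

theorem X_add_C_ne_zero (c : ℂ) : (RatFunc.X : RatFunc ℂ) + RatFunc.C c ≠ 0 := by
  have := RatFunc.algebraMap_ne_zero (Polynomial.X_add_C_ne_zero c)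
  simpa using this

theorem X_add_one_ne_zero : (RatFunc.X : RatFunc ℂ) + 1 ≠ 0 := by
  simpa using X_add_C_ne_zero 1

theorem X_sub_one_ne_zero : (RatFunc.X : RatFunc ℂ) - 1 ≠ 0 := by
  simpa [sub_eq_add_neg] using X_add_C_ne_zero (-1)

theorem chart_surjective (τ : TimeDomain) : Function.Surjective (chart τ) := by
  suffices h : ∃ t : RatFunc ℂ, Transcendental ℂ t ∧ chart τ t = RatFunc.X by
    obtain ⟨t, ht, h⟩ := h
    have : (chart τ).comp (substHom (RingHom.id ℂ) t ht) = RingHom.id _ :=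
      ratFunc_hom_ext (by simp) (by simp [h])
    exact fun f => ⟨_, congrArg (fun φ => φ f) this⟩
  cases τ with
  | discrete => exact ⟨RatFunc.X⁻¹, transcendental_X_inv, by simp [TimeDomain.coord]⟩
  | continuous =>
    -- This is `(1 + X) / (1 - X)`, the inverse of the Cayley coordinate, in a form whose
    -- injectivity is evident.
    refine ⟨RatFunc.C 2 * (1 - RatFunc.X)⁻¹ - 1, ?_, ?_⟩
    · refine transcendental_of_takesValue (infinite_compl_singleton 1)
        (v := fun z => 2 * (1 - z)⁻¹ - 1) (fun a _ b _ h => by simpa using h) fun z hz => ?_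
      exact ((takesValue_C 2 _).mul (((takesValue_one _).sub (takesValue_X z)).inv
        (sub_ne_zero.2 (Ne.symm hz)))).sub (takesValue_one _)
    · have h1 := X_add_one_ne_zero
      have h2 : (1 : RatFunc ℂ) - (RatFunc.X - 1) / (RatFunc.X + 1) = 2 / (RatFunc.X + 1) := by
        field_simp
        ring
      simp only [map_sub, map_mul, map_inv₀, map_one, map_ofNat, chart_X, TimeDomain.coord, h2]
      field_simp
      ring

theorem chart_injective (τ : TimeDomain) : Function.Injective (chart τ) :=
  (chart τ).injective

theorem coeffConj_chart (τ : TimeDomain) (f : RatFunc ℂ) :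
    coeffConj (chart τ f) = chart τ (coeffConj f) := by
  have : coeffConj.comp (chart τ) = (chart τ).comp coeffConj :=
    ratFunc_hom_ext (by simp) (by cases τ <;> simp [TimeDomain.coord])
  exact congrArg (fun φ => φ f) this

/-- In both time domains the conjugate of the coordinate is its inverse, because the coordinate maps
the boundary to the unit circle. Hence a single conjugation suffices in the disc. -/
theorem paraConjHom_chart (τ : TimeDomain) (f : RatFunc ℂ) :
    paraConjHom τ (chart τ f) = chart τ (paraConjHom .discrete f) := by
  have : (paraConjHom τ).comp (chart τ) = (chart τ).comp (paraConjHom .discrete) := by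
    refine ratFunc_hom_ext (by simp) ?_
    cases τ with
    | discrete => simp [TimeDomain.coord, TimeDomain.reflection]
    | continuous =>
      have h1 := X_add_one_ne_zero
      have h2 := X_sub_one_ne_zero
      simp only [RingHom.comp_apply, chart_X, TimeDomain.coord, map_div₀, map_sub, map_add,
        paraConjHom_X, map_one, TimeDomain.reflection, map_inv₀, inv_div]
      rw [← neg_div_neg_eq]
      congr 1 <;> ring
  exact congrArg (fun φ => φ f) this

theorem TakesValue.chart {g : RatFunc ℂ} {w c : ℂ} (h : TakesValue g w c) (τ : TimeDomain) :
    TakesValue (chart τ g) (τ.point w) c :=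
  h.substHom (transcendental_coord τ) (takesValue_coord τ w)

/-- A pole of `g` at `w` would be a zero of `g⁻¹`; transporting both values through the chart would
give `c * 0 = 1`. -/
theorem takesValue_of_chart {τ : TimeDomain} {g : RatFunc ℂ} {w c : ℂ}
    (h : TakesValue (chart τ g) (τ.point w) c) : TakesValue g w c := by
  rcases exists_takesValue_or_inv g w with ⟨d, hd⟩ | h0
  · rwa [h.unique (hd.chart τ)]
  · by_cases hg : g = 0
    · subst hg
      rw [map_zero] at h
      rw [h.unique (takesValue_zero _)]
      exact takesValue_zero _
    · have h1 := h.mul (h0.chart τ)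
      rw [← map_mul, mul_inv_cancel₀ hg, map_one] at h1
      simpa using h1.unique (takesValue_one _)

/-- The sign of `1 - ‖w‖ ^ 2` decides the side of the imaginary axis, which matches the disc with
the right half plane. -/
theorem re_cayley (w : ℂ) :
    ((1 + w) / (1 - w)).re = (1 - ‖w‖ ^ 2) / ‖1 - w‖ ^ 2 := by
  rw [Complex.div_re, ← add_div, ← Complex.normSq_eq_norm_sq, ← Complex.normSq_eq_norm_sq]
  congr 1
  simp [Complex.normSq_apply]
  ring

theorem point_mem_boundary (τ : TimeDomain) {w : ℂ} (hw : ‖w‖ = 1) : τ.point w ∈ τ.boundary := by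
  cases τ with
  | discrete =>
    have h0 : w ≠ 0 := by
      rintro rfl
      simp at hw
    exact ⟨w⁻¹, by simp [TimeDomain.point, h0], by simp [hw]⟩
  | continuous =>
    by_cases h0 : w = 1
    · exact Or.inl (by simp [TimeDomain.point, h0])
    · exact Or.inr ⟨_, by simp only [TimeDomain.point, if_neg h0]; rfl,
        by simp [re_cayley, hw]⟩

/-- The coordinate of a finite point outside the stability region of continuous time. -/
theorem continuous_point_inverse {s : ℂ} (hs : 0 ≤ s.re) :
    TimeDomain.continuous.point ((s - 1) / (s + 1)) = s ∧ 1 - (s - 1) / (s + 1) ≠ 0 := by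
  have h1 : s + 1 ≠ 0 := by
    intro h
    have := congrArg Complex.re h
    simp at this
    linarith
  have h2 : 1 - (s - 1) / (s + 1) = 2 / (s + 1) := by
    field_simp
    ring
  have h3 : 1 - (s - 1) / (s + 1) ≠ 0 := by
    rw [h2]
    exact div_ne_zero two_ne_zero h1
  refine ⟨?_, h3⟩
  simp only [TimeDomain.point, if_neg (Ne.symm (sub_ne_zero.1 h3)), OnePoint.coe_eq_coe]
  rw [h2]
  field_simp
  ring

theorem exists_point_of_notMem_stableRegion {τ : TimeDomain} {α : OnePoint ℂ}
    (hα : α ∉ τ.stableRegion) : ∃ w : ℂ, ‖w‖ ≤ 1 ∧ τ.point w = α := by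
  cases τ with
  | discrete =>
    induction α using OnePoint.rec with
    | infty => exact ⟨0, by simp, by simp [TimeDomain.point]⟩
    | coe z =>
      have hz : 1 ≤ ‖z‖ := not_lt.1 fun h => hα ⟨z, rfl, h⟩
      have h0 : z ≠ 0 := by
        rintro rfl
        norm_num at hz
      exact ⟨z⁻¹, by simpa using inv_le_one_of_one_le₀ hz, by simp [TimeDomain.point, h0]⟩
  | continuous =>
    induction α using OnePoint.rec with
    | infty => exact ⟨1, by simp, by simp [TimeDomain.point]⟩
    | coe s =>
      have hs : 0 ≤ s.re := not_lt.1 fun h => hα ⟨s, rfl, h⟩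
      obtain ⟨h1, h2⟩ := continuous_point_inverse hs
      refine ⟨_, ?_, h1⟩
      have h3 := re_cayley ((s - 1) / (s + 1))
      have h4 := h1
      simp only [TimeDomain.point, if_neg (Ne.symm (sub_ne_zero.1 h2)), OnePoint.coe_eq_coe] at h4
      rw [h4] at h3
      have h5 : 0 ≤ 1 - ‖(s - 1) / (s + 1)‖ ^ 2 := by
        have := norm_pos_iff.2 h2
        rw [h3, le_div_iff₀ (by positivity)] at hs
        simpa using hs
      nlinarith [norm_nonneg ((s - 1) / (s + 1))]

theorem exists_point_of_mem_boundary {τ : TimeDomain} {α : OnePoint ℂ}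
    (hα : α ∈ τ.boundary) : ∃ w : ℂ, ‖w‖ = 1 ∧ τ.point w = α := by
  cases τ with
  | discrete =>
    obtain ⟨z, rfl, hz⟩ := hα
    have h0 : z ≠ 0 := by
      rintro rfl
      norm_num at hz
    exact ⟨z⁻¹, by simp [hz], by simp [TimeDomain.point, h0]⟩
  | continuous =>
    rcases hα with rfl | ⟨s, rfl, hs⟩
    · exact ⟨1, by simp, by simp [TimeDomain.point]⟩
    · obtain ⟨h1, h2⟩ := continuous_point_inverse hs.ge
      refine ⟨_, ?_, h1⟩
      have h3 := re_cayley ((s - 1) / (s + 1))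
      have h4 := h1
      simp only [TimeDomain.point, if_neg (Ne.symm (sub_ne_zero.1 h2)), OnePoint.coe_eq_coe] at h4
      rw [h4, hs, eq_comm, div_eq_zero_iff] at h3
      rcases h3 with h3 | h3
      · have : (‖(s - 1) / (s + 1)‖ - 1) * (‖(s - 1) / (s + 1)‖ + 1) = 0 := by linarith
        rcases mul_eq_zero.1 this with h | h
        · linarith
        · linarith [norm_nonneg ((s - 1) / (s + 1))]
      · exact absurd h3 (pow_ne_zero _ (norm_ne_zero_iff.2 h2))

/-- On the boundary, `f^*` is the complex conjugate of `f`. -/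
theorem TakesValue.paraConjHom {τ : TimeDomain} {f : RatFunc ℂ} {α : OnePoint ℂ} {c : ℂ}
    (h : TakesValue f α c) (hα : α ∈ τ.boundary) :
    TakesValue (paraConjHom τ f) α (starRingEnd ℂ c) := by
  obtain ⟨w, hw, rfl⟩ := exists_point_of_mem_boundary hα
  obtain ⟨g, rfl⟩ := chart_surjective τ f
  rw [paraConjHom_chart]
  refine TakesValue.chart ?_ τ
  have hw0 : w ≠ 0 := by
    rintro rfl
    simp at hw
  refine (takesValue_of_chart h).substHom (transcendental_reflection _) ?_
  -- On the unit circle conjugation is inversion, so the substituted `X⁻¹` has the value `conj w` at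
  -- `w`.
  have h1 : starRingEnd ℂ w = w⁻¹ := by
    rw [Complex.inv_def, Complex.normSq_eq_norm_sq, hw]
    simp
  rw [h1]
  exact (takesValue_X w).inv hw0

section Matrices

variable {ι κ l : Type*}

/-! ### Values of rational matrices -/

/-- The rational matrix `W` is analytic at `α`, with value `A`. -/
def MatrixTakesValue (W : Matrix ι κ (RatFunc ℂ)) (α : OnePoint ℂ) (A : Matrix ι κ ℂ) : Prop :=
  ∀ i j, TakesValue (W i j) α (A i j)

theorem MatrixTakesValue.add {W V : Matrix ι κ (RatFunc ℂ)} {α : OnePoint ℂ} {A B : Matrix ι κ ℂ}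
    (hW : MatrixTakesValue W α A) (hV : MatrixTakesValue V α B) :
    MatrixTakesValue (W + V) α (A + B) :=
  fun i j => (hW i j).add (hV i j)

theorem MatrixTakesValue.mul [Fintype κ] {W : Matrix ι κ (RatFunc ℂ)} {V : Matrix κ l (RatFunc ℂ)}
    {α : OnePoint ℂ} {A : Matrix ι κ ℂ} {B : Matrix κ l ℂ}
    (hW : MatrixTakesValue W α A) (hV : MatrixTakesValue V α B) :
    MatrixTakesValue (W * V) α (A * B) := by
  intro i j
  simp only [Matrix.mul_apply]
  exact TakesValue.sum fun k _ => (hW i k).mul (hV k j)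

theorem matrixTakesValue_one [DecidableEq κ] (α : OnePoint ℂ) :
    MatrixTakesValue (1 : Matrix κ κ (RatFunc ℂ)) α 1 := by
  intro i j
  by_cases h : i = j
  · subst h
    simpa using takesValue_one α
  · simpa [h] using takesValue_zero α

theorem matrixTakesValue_map_C (A : Matrix ι κ ℂ) (α : OnePoint ℂ) :
    MatrixTakesValue (A.map RatFunc.C) α A :=
  fun _ _ => takesValue_C _ _

theorem MatrixTakesValue.unique {W : Matrix ι κ (RatFunc ℂ)} {α : OnePoint ℂ} {A B : Matrix ι κ ℂ}
    (hA : MatrixTakesValue W α A) (hB : MatrixTakesValue W α B) : A = B := by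
  ext i j
  exact (hA i j).unique (hB i j)

theorem MatrixTakesValue.det [Fintype κ] [DecidableEq κ] {W : Matrix κ κ (RatFunc ℂ)}
    {α : OnePoint ℂ} {A : Matrix κ κ ℂ} (h : MatrixTakesValue W α A) :
    TakesValue W.det α A.det := by
  simp only [Matrix.det_apply']
  refine TakesValue.sum fun σ _ => TakesValue.mul ?_ (TakesValue.prod fun i _ => h _ _)
  simpa using takesValue_C ((Equiv.Perm.sign σ : ℤ) : ℂ) α

theorem MatrixTakesValue.not_isPoleOf {W : Matrix ι κ (RatFunc ℂ)} {α : OnePoint ℂ}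
    {A : Matrix ι κ ℂ} (h : MatrixTakesValue W α A) : ¬ IsPoleOf W α :=
  fun ⟨i, j, hij⟩ => (h i j).not_hasPole hij

theorem matrixTakesValue_of_not_isPoleOf {W : Matrix ι κ (RatFunc ℂ)} {α : OnePoint ℂ}
    (h : ¬ IsPoleOf W α) : MatrixTakesValue W α (matrixValueAt W α) :=
  fun i j => takesValue_valueAt fun hij => h ⟨i, j, hij⟩

/-! ### The conjugate transpose -/

theorem paraConjTranspose_apply (τ : TimeDomain) (W : Matrix ι κ (RatFunc ℂ)) (i : κ) (j : ι) :
    paraConjTranspose τ W i j = paraConjHom τ (W j i) := by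
  simp [paraConjTranspose, paraConjHom_apply]

theorem paraConjTranspose_mul [Fintype κ] (τ : TimeDomain) (W : Matrix ι κ (RatFunc ℂ))
    (V : Matrix κ l (RatFunc ℂ)) :
    paraConjTranspose τ (W * V) = paraConjTranspose τ V * paraConjTranspose τ W := by
  ext i j
  simp [paraConjTranspose_apply, Matrix.mul_apply, mul_comm]

theorem paraConjTranspose_add (τ : TimeDomain) (W V : Matrix ι κ (RatFunc ℂ)) :
    paraConjTranspose τ (W + V) = paraConjTranspose τ W + paraConjTranspose τ V := by
  ext i j
  simp [paraConjTranspose_apply]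

theorem paraConjTranspose_smul (τ : TimeDomain) (f : RatFunc ℂ) (W : Matrix ι κ (RatFunc ℂ)) :
    paraConjTranspose τ (f • W) = paraConjHom τ f • paraConjTranspose τ W := by
  ext i j
  simp [paraConjTranspose_apply]

theorem paraConjTranspose_one [DecidableEq κ] (τ : TimeDomain) :
    paraConjTranspose τ (1 : Matrix κ κ (RatFunc ℂ)) = 1 := by
  ext i j
  by_cases h : i = j
  · subst h
    simp [paraConjTranspose_apply]
  · simp [paraConjTranspose_apply, h, Matrix.one_apply_ne' h]

theorem paraConjTranspose_paraConjTranspose (τ : TimeDomain) (W : Matrix ι κ (RatFunc ℂ)) :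
    paraConjTranspose τ (paraConjTranspose τ W) = W := by
  ext i j
  simp [paraConjTranspose_apply]

theorem paraConjTranspose_map_C (τ : TimeDomain) (A : Matrix ι κ ℂ) :
    paraConjTranspose τ (A.map RatFunc.C) = A.conjTranspose.map RatFunc.C := by
  ext i j
  simp [paraConjTranspose_apply]

theorem MatrixTakesValue.paraConjTranspose {τ : TimeDomain} {W : Matrix ι κ (RatFunc ℂ)}
    {α : OnePoint ℂ} {A : Matrix ι κ ℂ} (h : MatrixTakesValue W α A) (hα : α ∈ τ.boundary) :
    MatrixTakesValue (paraConjTranspose τ W) α A.conjTranspose := by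
  intro i j
  rw [paraConjTranspose_apply]
  exact (h j i).paraConjHom hα

/-! ### Functions analytic on the closed unit disc -/

/-- The ring of rational functions without poles in the closed unit disc. -/
def discRing : Subring (RatFunc ℂ) where
  carrier := {f | ∀ w : ℂ, ‖w‖ ≤ 1 → ∃ c, TakesValue f w c}
  mul_mem' hf hg w hw :=
    let ⟨_, hc⟩ := hf w hw
    let ⟨_, hd⟩ := hg w hw
    ⟨_, hc.mul hd⟩
  add_mem' hf hg w hw :=
    let ⟨_, hc⟩ := hf w hw
    let ⟨_, hd⟩ := hg w hw
    ⟨_, hc.add hd⟩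
  one_mem' _ _ := ⟨_, takesValue_one _⟩
  zero_mem' _ _ := ⟨_, takesValue_zero _⟩
  neg_mem' hf w hw :=
    let ⟨_, hc⟩ := hf w hw
    ⟨_, hc.neg⟩

theorem mem_discRing {f : RatFunc ℂ} :
    f ∈ discRing ↔ ∀ w : ℂ, ‖w‖ ≤ 1 → ∃ c, TakesValue f w c := Iff.rfl

theorem C_mem_discRing (c : ℂ) : RatFunc.C c ∈ discRing := fun _ _ => ⟨_, takesValue_C _ _⟩

theorem algebraMap_mem_discRing (p : ℂ[X]) : algebraMap ℂ[X] (RatFunc ℂ) p ∈ discRing :=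
  fun _ _ => ⟨_, takesValue_algebraMap _ _⟩

theorem inv_algebraMap_mem_discRing {p : ℂ[X]} (h : ∀ w : ℂ, ‖w‖ ≤ 1 → p.eval w ≠ 0) :
    (algebraMap ℂ[X] (RatFunc ℂ) p)⁻¹ ∈ discRing :=
  fun w hw => ⟨_, (takesValue_algebraMap p w).inv (h w hw)⟩

/-- All entries of the matrix `W` are analytic on the closed unit disc. -/
def IsDiscStable (W : Matrix ι κ (RatFunc ℂ)) : Prop := ∀ i j, W i j ∈ discRing

theorem IsDiscStable.mul [Fintype κ] {W : Matrix ι κ (RatFunc ℂ)} {V : Matrix κ l (RatFunc ℂ)}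
    (hW : IsDiscStable W) (hV : IsDiscStable V) : IsDiscStable (W * V) := by
  intro i j
  rw [Matrix.mul_apply]
  exact sum_mem fun k _ => mul_mem (hW i k) (hV k j)

theorem IsDiscStable.add {W V : Matrix ι κ (RatFunc ℂ)} (hW : IsDiscStable W)
    (hV : IsDiscStable V) : IsDiscStable (W + V) :=
  fun i j => add_mem (hW i j) (hV i j)

theorem IsDiscStable.sub {W V : Matrix ι κ (RatFunc ℂ)} (hW : IsDiscStable W)
    (hV : IsDiscStable V) : IsDiscStable (W - V) :=
  fun i j => sub_mem (hW i j) (hV i j)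

theorem IsDiscStable.smul {W : Matrix ι κ (RatFunc ℂ)} (hW : IsDiscStable W) {f : RatFunc ℂ}
    (hf : f ∈ discRing) : IsDiscStable (f • W) :=
  fun i j => mul_mem hf (hW i j)

theorem isDiscStable_map_C (A : Matrix ι κ ℂ) : IsDiscStable (A.map RatFunc.C) :=
  fun _ _ => C_mem_discRing _

theorem isDiscStable_one [DecidableEq κ] : IsDiscStable (1 : Matrix κ κ (RatFunc ℂ)) := by
  have h := isDiscStable_map_C (1 : Matrix κ κ ℂ)
  rwa [Matrix.map_one _ (map_zero _) (map_one _)] at h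

theorem IsDiscStable.exists_value {W : Matrix ι κ (RatFunc ℂ)} (hW : IsDiscStable W) {w : ℂ}
    (hw : ‖w‖ ≤ 1) : ∃ A, MatrixTakesValue W w A := by
  choose A hA using fun i j => hW i j w hw
  exact ⟨A, hA⟩

theorem IsDiscStable.det [Fintype κ] [DecidableEq κ] {W : Matrix κ κ (RatFunc ℂ)}
    (hW : IsDiscStable W) : W.det ∈ discRing := fun _ hw =>
  let ⟨_, hA⟩ := hW.exists_value hw
  ⟨_, hA.det⟩

/-! ### Blaschke factors -/

/-- The Blaschke factor with zero `a`. -/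
def blaschke (a : ℂ) : RatFunc ℂ :=
  (RatFunc.X - RatFunc.C a) / (1 - RatFunc.C (starRingEnd ℂ a) * RatFunc.X)

theorem one_sub_conj_mul_ne_zero {a w : ℂ} (ha : ‖a‖ < 1) (hw : ‖w‖ ≤ 1) :
    1 - starRingEnd ℂ a * w ≠ 0 := by
  intro h
  have h1 : ‖starRingEnd ℂ a * w‖ = 1 := by
    rw [← sub_eq_zero.1 h, norm_one]
  rw [norm_mul, RCLike.norm_conj] at h1
  nlinarith [norm_nonneg a, norm_nonneg w]

theorem takesValue_one_sub_conj_mul_X (a w : ℂ) :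
    TakesValue (1 - RatFunc.C (starRingEnd ℂ a) * RatFunc.X) w (1 - starRingEnd ℂ a * w) :=
  (takesValue_one _).sub ((takesValue_C _ _).mul (takesValue_X w))

theorem takesValue_blaschke {a w : ℂ} (ha : ‖a‖ < 1) (hw : ‖w‖ ≤ 1) :
    TakesValue (blaschke a) w ((w - a) / (1 - starRingEnd ℂ a * w)) :=
  ((takesValue_X w).sub (takesValue_C a _)).div (takesValue_one_sub_conj_mul_X a w)
    (one_sub_conj_mul_ne_zero ha hw)

theorem X_sub_C_ne_zero' (a : ℂ) : (RatFunc.X - RatFunc.C a : RatFunc ℂ) ≠ 0 := by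
  simpa [sub_eq_add_neg] using X_add_C_ne_zero (-a)

theorem one_sub_conj_mul_X_ne_zero {a : ℂ} :
    (1 - RatFunc.C (starRingEnd ℂ a) * RatFunc.X : RatFunc ℂ) ≠ 0 := by
  intro h
  have h1 := takesValue_one_sub_conj_mul_X a 0
  rw [h] at h1
  simpa using (takesValue_zero _).unique h1

theorem blaschke_ne_zero (a : ℂ) : blaschke a ≠ 0 :=
  div_ne_zero (X_sub_C_ne_zero' a) one_sub_conj_mul_X_ne_zero

theorem paraConjHom_blaschke (a : ℂ) :
    paraConjHom .discrete (blaschke a) = (blaschke a)⁻¹ := by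
  have h0 := RatFunc.X_ne_zero (K := ℂ)
  have h1 := X_sub_C_ne_zero' a
  have h2 : (1 - RatFunc.C a * RatFunc.X⁻¹ : RatFunc ℂ) ≠ 0 := by
    intro h
    apply h1
    field_simp at h
    simpa using h
  simp only [blaschke, map_div₀, map_sub, map_mul, paraConjHom_X, paraConjHom_C, map_one,
    TimeDomain.reflection, inv_div, Complex.conj_conj]
  rw [div_eq_div_iff h2 h1]
  field_simp

/-- The only pole of the inverse factor in the closed disc is simple and lies at `a`, where the zero
of `f` cancels it. -/
theorem blaschke_inv_mul_mem_discRing {a : ℂ} (ha : ‖a‖ < 1) {f : RatFunc ℂ} (hf : f ∈ discRing)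
    (h0 : TakesValue f a 0) : (blaschke a)⁻¹ * f ∈ discRing := by
  intro w hw
  by_cases hwa : w = a
  · subst hwa
    obtain ⟨n, p, q, -, -, hq, rfl, hpq⟩ := h0
    have hp : p.eval w = 0 := by
      rcases div_eq_zero_iff.1 hpq.symm with h | h
      · exact h
      · exact absurd h hq
    obtain ⟨r, rfl⟩ := dvd_iff_isRoot.2 hp
    have h := (takesValue_one_sub_conj_mul_X w w).mul
      ((takesValue_algebraMap r w).div (takesValue_algebraMap q w) hq)
    refine ⟨(1 - starRingEnd ℂ w * w) * (r.eval w / q.eval w), ?_⟩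
    convert h using 1
    have h1 := X_sub_C_ne_zero' w
    simp only [blaschke, inv_div, map_mul, map_sub, RatFunc.algebraMap_X, RatFunc.algebraMap_C]
    field_simp
  · obtain ⟨c, hc⟩ := hf w hw
    exact ⟨_, ((takesValue_blaschke ha hw).inv
      (div_ne_zero (sub_ne_zero.2 hwa) (one_sub_conj_mul_ne_zero ha hw))).mul hc⟩

/-- The Blaschke product with the given zeros. -/
def blaschkeProd (s : Multiset ℂ) : RatFunc ℂ := (s.map blaschke).prod

theorem blaschkeProd_ne_zero (s : Multiset ℂ) : blaschkeProd s ≠ 0 := by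
  refine Multiset.prod_ne_zero fun h => ?_
  obtain ⟨a, -, ha⟩ := Multiset.mem_map.1 h
  exact blaschke_ne_zero a ha

theorem paraConjHom_blaschkeProd_mul (s : Multiset ℂ) :
    paraConjHom .discrete (blaschkeProd s) * blaschkeProd s = 1 := by
  have h : paraConjHom .discrete (blaschkeProd s) = (blaschkeProd s)⁻¹ := by
    rw [blaschkeProd, map_multiset_prod, Multiset.map_map, ← Multiset.prod_map_inv]
    simp [paraConjHom_blaschke]
  rw [h, inv_mul_cancel₀ (blaschkeProd_ne_zero s)]

theorem takesValue_blaschkeProd {s : Multiset ℂ} (hs : ∀ a ∈ s, ‖a‖ < 1) {w : ℂ} (hw : ‖w‖ ≤ 1) :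
    TakesValue (blaschkeProd s) w
      (s.map fun a => (w - a) / (1 - starRingEnd ℂ a * w)).prod := by
  induction s using Multiset.induction_on with
  | empty => simpa [blaschkeProd] using takesValue_one _
  | cons a s ih =>
    have := (takesValue_blaschke (hs a (by simp)) hw).mul (ih fun b hb => hs b (by simp [hb]))
    simpa [blaschkeProd] using this

theorem blaschkeProd_mem_discRing {s : Multiset ℂ} (hs : ∀ a ∈ s, ‖a‖ < 1) :
    blaschkeProd s ∈ discRing := fun _ hw => ⟨_, takesValue_blaschkeProd hs hw⟩

theorem mem_of_takesValue_blaschkeProd_zero {s : Multiset ℂ} (hs : ∀ a ∈ s, ‖a‖ < 1) {w : ℂ}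
    (hw : ‖w‖ ≤ 1) (h : TakesValue (blaschkeProd s) w 0) : w ∈ s := by
  have h1 := (takesValue_blaschkeProd hs hw).unique h
  rw [Multiset.prod_eq_zero_iff, Multiset.mem_map] at h1
  obtain ⟨a, ha, h2⟩ := h1
  rw [div_eq_zero_iff, or_iff_left (one_sub_conj_mul_ne_zero (hs a ha) hw), sub_eq_zero] at h2
  rwa [h2]

/-- The denominators `1 - conj a * X` do not vanish on the closed disc, so only the numerators of
the Blaschke product matter. -/
theorem blaschkeProd_mul_mem_discRing {s : Multiset ℂ} (hs : ∀ a ∈ s, ‖a‖ < 1) {f : RatFunc ℂ}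
    (hf : (s.map fun a => (RatFunc.X - RatFunc.C a : RatFunc ℂ)).prod * f ∈ discRing) :
    blaschkeProd s * f ∈ discRing := by
  have h : blaschkeProd s = (s.map fun a =>
      (1 - RatFunc.C (starRingEnd ℂ a) * RatFunc.X : RatFunc ℂ)⁻¹).prod *
      (s.map fun a => (RatFunc.X - RatFunc.C a : RatFunc ℂ)).prod := by
    rw [← Multiset.prod_map_mul, blaschkeProd]
    congr 2
    funext a
    rw [blaschke, div_eq_inv_mul]
  rw [h, mul_assoc]
  refine mul_mem (multiset_prod_mem _ fun g hg => ?_) hf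
  obtain ⟨a, ha, rfl⟩ := Multiset.mem_map.1 hg
  exact fun w hw => ⟨_, (takesValue_one_sub_conj_mul_X a w).inv
    (one_sub_conj_mul_ne_zero (hs a ha) hw)⟩

/-- Poles in the open disc of a function without poles on the circle are removed by a Blaschke
product. -/
theorem exists_blaschkeProd_smul_isDiscStable [Fintype ι] [Fintype κ] (T : Matrix ι κ (RatFunc ℂ))
    (hT : ∀ w : ℂ, ‖w‖ = 1 → ∃ A, MatrixTakesValue T w A) :
    ∃ s : Multiset ℂ, (∀ a ∈ s, ‖a‖ < 1) ∧ IsDiscStable (blaschkeProd s • T) := by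
  classical
  let q : ℂ[X] := ∏ i, ∏ j, (T i j).denom
  have hq : q ≠ 0 :=
    Finset.prod_ne_zero_iff.2 fun i _ => Finset.prod_ne_zero_iff.2 fun j _ => (T i j).denom_ne_zero
  have hcircle : ∀ w : ℂ, ‖w‖ = 1 → q.eval w ≠ 0 := by
    intro w hw h
    simp only [q, eval_prod, Finset.prod_eq_zero_iff] at h
    obtain ⟨i, -, j, -, h⟩ := h
    obtain ⟨A, hA⟩ := hT w hw
    exact (hA i j).not_hasPole h
  -- The roots of the common denominator `q` are split: those in the open disc form `s`. The others
  -- avoid the circle, so `r` has no zero in the closed disc.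
  obtain ⟨s, r, hs, hqr, hr⟩ : ∃ (s : Multiset ℂ) (r : ℂ[X]), (∀ a ∈ s, ‖a‖ < 1) ∧
      q = (s.map fun a => X - C a).prod * r ∧ ∀ w : ℂ, ‖w‖ ≤ 1 → r.eval w ≠ 0 := by
    let t := q.roots.filter fun a => ¬ ‖a‖ < 1
    refine ⟨q.roots.filter fun a => ‖a‖ < 1, C q.leadingCoeff * (t.map fun a => X - C a).prod,
      fun a ha => (Multiset.mem_filter.1 ha).2, ?_, ?_⟩
    · have h1 := (IsAlgClosed.splits q).eq_prod_roots
      rw [← Multiset.filter_add_not (fun a => ‖a‖ < 1) q.roots, Multiset.map_add,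
        Multiset.prod_add] at h1
      rw [mul_left_comm, ← h1]
    · intro w hw h
      simp only [eval_mul, eval_C, mul_eq_zero, leadingCoeff_eq_zero, hq, false_or,
        eval_multiset_prod, Multiset.prod_eq_zero_iff, Multiset.map_map, Multiset.mem_map] at h
      obtain ⟨a, ha, h⟩ := h
      simp only [Function.comp_apply, eval_sub, eval_X, eval_C, sub_eq_zero] at h
      subst h
      rw [Multiset.mem_filter, mem_roots hq] at ha
      exact hcircle w (le_antisymm hw (not_lt.1 ha.2)) ha.1
  refine ⟨s, hs, fun i j => blaschkeProd_mul_mem_discRing hs ?_⟩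
  have hd : (T i j).denom ∣ q :=
    (Finset.dvd_prod_of_mem (fun j => (T i j).denom) (Finset.mem_univ j)).trans
      (Finset.dvd_prod_of_mem (fun i => ∏ j, (T i j).denom) (Finset.mem_univ i))
  obtain ⟨e, he⟩ := hd
  have h1 : algebraMap ℂ[X] (RatFunc ℂ) q * T i j =
      algebraMap ℂ[X] (RatFunc ℂ) (e * (T i j).num) := by
    rw [he, map_mul, map_mul, ← mul_denom_eq_num]
    ring
  have hr0 : r ≠ 0 := right_ne_zero_of_mul (hqr ▸ hq)
  have h2 : (s.map fun a => (RatFunc.X - RatFunc.C a : RatFunc ℂ)).prod * T i j =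
      (algebraMap ℂ[X] (RatFunc ℂ) r)⁻¹ * algebraMap ℂ[X] (RatFunc ℂ) (e * (T i j).num) := by
    rw [← h1, hqr, map_mul, map_multiset_prod, Multiset.map_map, mul_assoc,
      mul_left_comm _ (algebraMap ℂ[X] (RatFunc ℂ) r)]
    have := RatFunc.algebraMap_ne_zero hr0
    simp only [Function.comp_def, map_sub, RatFunc.algebraMap_X, RatFunc.algebraMap_C]
    field_simp
  rw [h2]
  exact mul_mem (inv_algebraMap_mem_discRing hr) (algebraMap_mem_discRing _)

end Matrices

section Matrices

variable {ι κ l : Type*}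

/-! ### Blaschke–Potapov factors -/

/-- The orthogonal projection onto the line spanned by `v`. -/
def lineProj [Fintype κ] (v : κ → ℂ) : Matrix κ κ ℂ :=
  (v ⬝ᵥ star v)⁻¹ • Matrix.vecMulVec v (star v)

theorem lineProj_mul_self [Fintype κ] {v : κ → ℂ} (hv : v ≠ 0) :
    lineProj v * lineProj v = lineProj v := by
  have h : v ⬝ᵥ star v ≠ 0 := fun h =>
    hv (dotProduct_star_self_eq_zero.1 ((dotProduct_comm _ _).trans h))
  rw [lineProj, Matrix.smul_mul, Matrix.mul_smul, Matrix.vecMulVec_mul_vecMulVec,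
    dotProduct_comm (star v), Matrix.vecMulVec_smul, smul_smul, smul_smul]
  congr 1
  field_simp

theorem conjTranspose_lineProj [Fintype κ] (v : κ → ℂ) :
    (lineProj v).conjTranspose = lineProj v := by
  have h : star (v ⬝ᵥ star v) = v ⬝ᵥ star v := by
    rw [← Matrix.star_dotProduct_star, star_star, dotProduct_comm]
  rw [lineProj, Matrix.conjTranspose_smul, star_inv₀, h, Matrix.conjTranspose_vecMulVec, star_star]

theorem mul_lineProj_eq_zero [Fintype κ] {A : Matrix ι κ ℂ} {v : κ → ℂ} (h : A.mulVec v = 0) :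
    A * lineProj v = 0 := by
  rw [lineProj, Matrix.mul_smul, Matrix.mul_vecMulVec, h, Matrix.zero_vecMulVec, smul_zero]

theorem map_C_lineProj_mul_self [Fintype κ] {v : κ → ℂ} (hv : v ≠ 0) :
    (lineProj v).map RatFunc.C * (lineProj v).map RatFunc.C = (lineProj v).map RatFunc.C := by
  rw [← Matrix.map_mul, lineProj_mul_self hv]

variable [Fintype κ] [DecidableEq κ]

/-- The matrix acting as `f` on the line spanned by `v`, and as the identity on its orthogonal
complement. -/
def potapov (f : RatFunc ℂ) (v : κ → ℂ) : Matrix κ κ (RatFunc ℂ) :=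
  1 + (f - 1) • (lineProj v).map RatFunc.C

theorem potapov_mul {v : κ → ℂ} (hv : v ≠ 0) (f g : RatFunc ℂ) :
    potapov f v * potapov g v = potapov (f * g) v := by
  simp only [potapov, add_mul, mul_add, one_mul, mul_one, Matrix.smul_mul, Matrix.mul_smul,
    map_C_lineProj_mul_self hv, smul_smul]
  have h : f * g - 1 = (f - 1) + (g - 1) + (g - 1) * (f - 1) := by ring
  rw [h, add_smul, add_smul]
  abel

@[simp]
theorem potapov_one (v : κ → ℂ) : potapov 1 v = 1 := by
  simp [potapov]

theorem paraConjTranspose_potapov (τ : TimeDomain) (f : RatFunc ℂ) (v : κ → ℂ) :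
    paraConjTranspose τ (potapov f v) = potapov (paraConjHom τ f) v := by
  rw [potapov, paraConjTranspose_add, paraConjTranspose_one, paraConjTranspose_smul,
    paraConjTranspose_map_C, conjTranspose_lineProj, map_sub, map_one, potapov]

/-- The factor is a rank-one perturbation of the identity, so the matrix determinant lemma applies.
Dividing by a Potapov factor therefore removes exactly one Blaschke factor from a determinant. -/
theorem det_potapov {v : κ → ℂ} (hv : v ≠ 0) (f : RatFunc ℂ) : (potapov f v).det = f := by
  have h : v ⬝ᵥ star v ≠ 0 := fun h =>
    hv (dotProduct_star_self_eq_zero.1 ((dotProduct_comm _ _).trans h))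
  have h1 : (f - 1) • (lineProj v).map RatFunc.C =
      Matrix.replicateCol Unit (((f - 1) * RatFunc.C (v ⬝ᵥ star v)⁻¹) • (RatFunc.C ∘ v)) *
        Matrix.replicateRow Unit (RatFunc.C ∘ star v) := by
    rw [← Matrix.vecMulVec_eq]
    ext i j
    simp [lineProj, Matrix.vecMulVec_apply]
    ring
  have h2 : (RatFunc.C ∘ star v) ⬝ᵥ (RatFunc.C ∘ v) = RatFunc.C (v ⬝ᵥ star v) := by
    rw [dotProduct_comm, dotProduct, dotProduct, map_sum]
    simp
  rw [potapov, h1, Matrix.det_one_add_replicateCol_mul_replicateRow, dotProduct_smul, h2,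
    smul_eq_mul, mul_assoc, ← map_mul, inv_mul_cancel₀ h]
  simp

/-- The pole of `(blaschke a)⁻¹` meets only the component `W * lineProj v`, which vanishes at `a`.
-/
theorem isDiscStable_mul_potapov [Fintype ι] {W : Matrix ι κ (RatFunc ℂ)} (hW : IsDiscStable W)
    {a : ℂ} (ha : ‖a‖ < 1) {A : Matrix ι κ ℂ} (hA : MatrixTakesValue W a A) {v : κ → ℂ}
    (hv : A.mulVec v = 0) : IsDiscStable (W * potapov (blaschke a)⁻¹ v) := by
  have h1 : MatrixTakesValue (W * (lineProj v).map RatFunc.C) a 0 := by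
    rw [← mul_lineProj_eq_zero hv]
    exact hA.mul (matrixTakesValue_map_C _ _)
  have h2 := hW.mul (isDiscStable_map_C (lineProj v))
  have h3 : W * potapov (blaschke a)⁻¹ v = W - W * (lineProj v).map RatFunc.C +
      (blaschke a)⁻¹ • (W * (lineProj v).map RatFunc.C) := by
    rw [potapov, Matrix.mul_add, Matrix.mul_one, Matrix.mul_smul, sub_smul, one_smul]
    abel
  rw [h3]
  exact (hW.sub h2).add fun i j => blaschke_inv_mul_mem_discRing ha (h2 i j) (h1 i j)

/-! ### Removal of common zeros -/

/-- Common zeros of the denominator and the numerator can be divided out by Blaschke–Potapov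
factors, until none is left. -/
theorem exists_inner_denom_without_common_zero [Fintype ι] (T : Matrix ι κ (RatFunc ℂ))
    (s : Multiset ℂ) (hs : ∀ a ∈ s, ‖a‖ < 1) (D : Matrix κ κ (RatFunc ℂ)) (hD : IsDiscStable D)
    (hN : IsDiscStable (T * D)) (hinner : paraConjTranspose .discrete D * D = 1)
    (hdet : D.det = blaschkeProd s) :
    ∃ D' : Matrix κ κ (RatFunc ℂ), IsDiscStable D' ∧ IsDiscStable (T * D') ∧
      paraConjTranspose .discrete D' * D' = 1 ∧
      ∀ w : ℂ, ‖w‖ ≤ 1 → ∀ A B, MatrixTakesValue D' w A → MatrixTakesValue (T * D') w B →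
        ∀ v : κ → ℂ, A.mulVec v = 0 → B.mulVec v = 0 → v = 0 := by
  classical
  by_cases hcop : ∀ w : ℂ, ‖w‖ ≤ 1 → ∀ A B, MatrixTakesValue D w A →
      MatrixTakesValue (T * D) w B → ∀ v : κ → ℂ, A.mulVec v = 0 → B.mulVec v = 0 → v = 0
  · exact ⟨D, hD, hN, hinner, hcop⟩
  · push Not at hcop
    obtain ⟨w, hw, A, B, hA, hB, v, hAv, hBv, hv⟩ := hcop
    -- A common kernel vector makes `det D` vanish at `w`, so `w` belongs to `s` and lies in the
    -- open disc. Erasing `w` from `s` is the descent of the recursion.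
    have hdet0 : TakesValue (blaschkeProd s) w 0 := by
      have h := hA.det
      rwa [hdet, Matrix.exists_mulVec_eq_zero_iff.1 ⟨v, hv, hAv⟩] at h
    have hws := mem_of_takesValue_blaschkeProd_zero hs hw hdet0
    have hw1 := hs w hws
    have hcard := Multiset.card_erase_lt_of_mem hws
    have hb := blaschke_ne_zero w
    refine exists_inner_denom_without_common_zero T (s.erase w)
      (fun a ha => hs a (Multiset.mem_of_mem_erase ha)) (D * potapov (blaschke w)⁻¹ v)
      (isDiscStable_mul_potapov hD hw1 hA hAv) ?_ ?_ ?_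
    · rw [← Matrix.mul_assoc]
      exact isDiscStable_mul_potapov hN hw1 hB hBv
    · rw [paraConjTranspose_mul, paraConjTranspose_potapov, map_inv₀, paraConjHom_blaschke, inv_inv,
        Matrix.mul_assoc, ← Matrix.mul_assoc _ D, hinner, one_mul, potapov_mul hv,
        mul_inv_cancel₀ hb, potapov_one]
    · rw [Matrix.det_mul, det_potapov hv, hdet, ← Multiset.cons_erase hws]
      simp only [blaschkeProd, Multiset.map_cons, Multiset.prod_cons, Multiset.erase_cons_head]
      field_simp
termination_by s.card

/-! ### Left inverses -/

theorem exists_mul_eq_one_of_injective [Fintype ι] (A : Matrix ι κ ℂ)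
    (hA : ∀ v, A.mulVec v = 0 → v = 0) : ∃ K : Matrix κ ι ℂ, K * A = 1 := by
  classical
  obtain ⟨g, hg⟩ := A.mulVecLin.exists_leftInverse_of_injective
    (LinearMap.ker_eq_bot'.2 fun v hv => hA v hv)
  refine ⟨LinearMap.toMatrix' g, ?_⟩
  have h : A = LinearMap.toMatrix' A.mulVecLin := by
    rw [← Matrix.toLin'_apply', LinearMap.toMatrix'_toLin']
  rw [h, ← LinearMap.toMatrix'_comp, hg, LinearMap.toMatrix'_id]

/-- A matrix over the ring of functions analytic on the closed disc with pointwise independent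
columns has a left inverse. -/
theorem exists_isDiscStable_leftInverse [Fintype ι] (W : Matrix ι κ (RatFunc ℂ))
    (hW : IsDiscStable W)
    (hinj : ∀ w : ℂ, ‖w‖ ≤ 1 → ∀ A, MatrixTakesValue W w A → ∀ v, A.mulVec v = 0 → v = 0) :
    ∃ Z : Matrix κ ι (RatFunc ℂ), IsDiscStable Z ∧ Z * W = 1 := by
  -- The ideal of polynomials `r` such that `r • 1` is a stable left multiple of `W`. Its elements
  -- have no common zero in the closed disc, so neither has its generator, which is thus a unit of
  -- `discRing` and can be divided out.
  let J : Ideal ℂ[X] :=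
    { carrier := {r | ∃ Z : Matrix κ ι (RatFunc ℂ), IsDiscStable Z ∧
        Z * W = algebraMap ℂ[X] (RatFunc ℂ) r • 1}
      add_mem' := by
        rintro a b ⟨Z, hZ, hZa⟩ ⟨Y, hY, hYb⟩
        exact ⟨Z + Y, hZ.add hY, by rw [Matrix.add_mul, hZa, hYb, map_add, add_smul]⟩
      zero_mem' := ⟨0, fun _ _ => zero_mem _, by simp⟩
      smul_mem' := by
        rintro a b ⟨Z, hZ, hZb⟩
        exact ⟨_, hZ.smul (algebraMap_mem_discRing a), by
          rw [Matrix.smul_mul, hZb, smul_eq_mul, map_mul, smul_smul]⟩ }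
  have hpoint : ∀ w : ℂ, ‖w‖ ≤ 1 → ∃ r ∈ J, r.eval w ≠ 0 := by
    intro w hw
    obtain ⟨A, hA⟩ := hW.exists_value hw
    -- With `K` a left inverse of `W(w)`, the determinant `d` of `K W` is `1` at `w`. The adjugate,
    -- scaled by `d.denom`, puts `d.num` in `J`, and `d.num` agrees with `d.denom` at `w`.
    obtain ⟨K, hK⟩ := exists_mul_eq_one_of_injective A (hinj w hw A hA)
    have hM : IsDiscStable (K.map RatFunc.C * W) := (isDiscStable_map_C K).mul hW
    have hadj : IsDiscStable (K.map RatFunc.C * W).adjugate := by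
      intro i j
      rw [Matrix.adjugate_apply]
      refine IsDiscStable.det fun k l => ?_
      by_cases hk : k = j
      · subst hk
        rw [Matrix.updateRow_self]
        simp only [Pi.single_apply]
        split_ifs
        · exact one_mem _
        · exact zero_mem _
      · rw [Matrix.updateRow_ne hk]
        exact hM k l
    have hdet : TakesValue (K.map RatFunc.C * W).det w 1 := by
      have h := ((matrixTakesValue_map_C K w).mul hA).det
      rwa [hK, Matrix.det_one] at h
    set d := (K.map RatFunc.C * W).det with hd
    refine ⟨d.num, ⟨algebraMap ℂ[X] (RatFunc ℂ) d.denom •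
      ((K.map RatFunc.C * W).adjugate * K.map RatFunc.C),
      (hadj.mul (isDiscStable_map_C K)).smul (algebraMap_mem_discRing _), ?_⟩, ?_⟩
    · rw [Matrix.smul_mul, Matrix.mul_assoc, Matrix.adjugate_mul, smul_smul, ← hd, mul_comm,
        mul_denom_eq_num]
    · have h1 : d.denom.eval w ≠ 0 := hdet.not_hasPole
      have h2 := hdet.mul (takesValue_algebraMap d.denom w)
      rw [mul_denom_eq_num] at h2
      rwa [(takesValue_algebraMap d.num w).unique h2, one_mul]
  obtain ⟨g, hg⟩ := IsPrincipalIdealRing.principal J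
  have hgJ : g ∈ J := by
    rw [hg]
    exact Ideal.mem_span_singleton_self g
  have hg0 : ∀ w : ℂ, ‖w‖ ≤ 1 → g.eval w ≠ 0 := by
    intro w hw h
    obtain ⟨r, hr, hr0⟩ := hpoint w hw
    rw [hg] at hr
    obtain ⟨e, rfl⟩ := Ideal.mem_span_singleton.1 hr
    exact hr0 (by simp [h])
  obtain ⟨Z, hZ, hZg⟩ := hgJ
  refine ⟨_, hZ.smul (inv_algebraMap_mem_discRing hg0), ?_⟩
  have hg1 : g ≠ 0 := by
    rintro rfl
    exact hg0 0 (by simp) (by simp)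
  rw [Matrix.smul_mul, hZg, smul_smul, inv_mul_cancel₀ (RatFunc.algebraMap_ne_zero hg1), one_smul]

/-! ### Coprime factorizations with inner denominator -/

/-- A coprime factorization with inner denominator over the ring of rational functions without
poles in the closed unit disc. -/
structure IsDiscFactorization [Fintype ι] (T N : Matrix ι κ (RatFunc ℂ))
    (D X : Matrix κ κ (RatFunc ℂ)) (Y : Matrix κ ι (RatFunc ℂ)) : Prop where
  stable_num : IsDiscStable N
  stable_denom : IsDiscStable D
  stable_left : IsDiscStable X
  stable_right : IsDiscStable Y
  mul_denom : T * D = N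
  inner : paraConjTranspose .discrete D * D = 1
  bezout : X * D + Y * N = 1

theorem exists_isDiscFactorization [Fintype ι] (T : Matrix ι κ (RatFunc ℂ))
    (hT : ∀ w : ℂ, ‖w‖ = 1 → ∃ A, MatrixTakesValue T w A) :
    ∃ N D X Y, IsDiscFactorization T N D X Y := by
  classical
  obtain ⟨s, hs, hsT⟩ := exists_blaschkeProd_smul_isDiscStable T hT
  -- The determinant of the scalar matrix is a power with exponent `card κ`, whence `card κ` copies
  -- of `s`.
  obtain ⟨D, hD, hN, hinner, hcop⟩ := exists_inner_denom_without_common_zero T (Fintype.card κ • s)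
    (fun a ha => hs a (Multiset.mem_of_mem_nsmul ha)) (blaschkeProd s • 1)
    (isDiscStable_one.smul (blaschkeProd_mem_discRing hs))
    (by rwa [Matrix.mul_smul, Matrix.mul_one])
    (by rw [paraConjTranspose_smul, paraConjTranspose_one, smul_mul_smul_comm,
      paraConjHom_blaschkeProd_mul, one_smul, Matrix.one_mul])
    (by simp [blaschkeProd, Multiset.map_nsmul, Multiset.prod_nsmul])
  obtain ⟨Z, hZ, hZ1⟩ := exists_isDiscStable_leftInverse (Matrix.fromRows D (T * D))
    (by rintro (i | i) j; exacts [hD i j, hN i j])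
    (by
      intro w hw A hA v hv
      refine hcop w hw A.toRows₁ A.toRows₂ (fun i j => hA (Sum.inl i) j)
        (fun i j => hA (Sum.inr i) j) v ?_ ?_
      · funext i
        exact congrFun hv (Sum.inl i)
      · funext i
        exact congrFun hv (Sum.inr i))
  refine ⟨T * D, D, Z.toCols₁, Z.toCols₂, hN, hD, fun i j => hZ i _, fun i j => hZ i _, rfl, hinner,
    ?_⟩
  rw [← Matrix.fromCols_mul_fromRows, Matrix.fromCols_toCols, hZ1]

end Matrices

section Matrices

variable {ι κ l : Type*}

/-! ### Real coefficients -/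

theorem TakesValue.coeffConj {f : RatFunc ℂ} {w c : ℂ} (h : TakesValue f w c) :
    TakesValue (coeffConj f) (starRingEnd ℂ w : ℂ) (starRingEnd ℂ c) :=
  h.substHom RatFunc.transcendental_X (takesValue_X _)

theorem coeffConj_mem_discRing {f : RatFunc ℂ} (hf : f ∈ discRing) : coeffConj f ∈ discRing := by
  intro w hw
  obtain ⟨c, hc⟩ := hf (starRingEnd ℂ w) (by rwa [RCLike.norm_conj])
  have := hc.coeffConj
  rw [Complex.conj_conj] at this
  exact ⟨_, this⟩

theorem IsDiscStable.coeffConj {W : Matrix ι κ (RatFunc ℂ)} (hW : IsDiscStable W) :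
    IsDiscStable (W.map coeffConj) :=
  fun i j => coeffConj_mem_discRing (hW i j)

theorem paraConjHom_coeffConj (τ : TimeDomain) (f : RatFunc ℂ) :
    paraConjHom τ (coeffConj f) = coeffConj (paraConjHom τ f) := by
  have : (paraConjHom τ).comp coeffConj = coeffConj.comp (paraConjHom τ) :=
    ratFunc_hom_ext (by simp) (by cases τ <;> simp [TimeDomain.reflection])
  exact congrArg (fun φ => φ f) this

theorem paraConjTranspose_coeffConj (τ : TimeDomain) (W : Matrix ι κ (RatFunc ℂ)) :
    paraConjTranspose τ (W.map coeffConj) = (paraConjTranspose τ W).map coeffConj := by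
  ext i j
  simp [paraConjTranspose_apply, paraConjHom_coeffConj]

/-- If both `f` and `f^*` are analytic on the closed unit disc, then `f` is constant. -/
theorem exists_eq_C_of_mem_discRing {f : RatFunc ℂ} (hf : f ∈ discRing)
    (hf' : paraConjHom .discrete f ∈ discRing) : ∃ c, f = RatFunc.C c := by
  have hden : f.denom.natDegree = 0 := by
    by_contra h
    obtain ⟨a, ha⟩ := IsAlgClosed.exists_root f.denom
      (fun h0 => h (natDegree_eq_of_degree_eq_some h0))
    obtain ⟨c, hc⟩ : ∃ c, TakesValue f a c := by
      by_cases ha1 : ‖a‖ ≤ 1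
      · exact hf a ha1
      -- Outside the disc, analyticity at `a` comes from that of `f^*` at the reflected point `1 /
      -- conj a`.
      · have ha0 : a ≠ 0 := by
          rintro rfl
          simp at ha1
        obtain ⟨c, hc⟩ := hf' (starRingEnd ℂ a)⁻¹ (by
          rw [norm_inv, RCLike.norm_conj]
          exact inv_le_one_of_one_le₀ (not_le.1 ha1).le)
        have h1 : TakesValue (RatFunc.X⁻¹) a (starRingEnd ℂ (starRingEnd ℂ a)⁻¹) := by
          rw [map_inv₀, Complex.conj_conj]
          exact (takesValue_X a).inv ha0
        have h2 := hc.substHom (transcendental_reflection .discrete) h1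
        exact ⟨_, (paraConjHom_paraConjHom .discrete f) ▸ h2⟩
    exact hc.not_hasPole ha
  refine (RatFunc.eq_C_iff f).2 ⟨?_, hden⟩
  -- Analyticity of `f^*` at `0` excludes a pole of `f` at `∞`, which bounds the degree of the
  -- numerator.
  obtain ⟨c, hc⟩ := hf' 0 (by simp)
  have h1 : TakesValue (RatFunc.X⁻¹) OnePoint.infty (starRingEnd ℂ 0) := by
    rw [map_zero]
    exact takesValue_X_inv_infty
  have h2 := hc.substHom (transcendental_reflection .discrete) h1
  have h3 : ¬ HasPole f OnePoint.infty := by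
    rw [← paraConjHom_paraConjHom .discrete f]
    exact h2.not_hasPole
  simpa [HasPole, RatFunc.intDegree, hden] using h3

variable [Fintype ι] [Fintype κ] [DecidableEq κ]

/-- The inner denominator of a real rational matrix is real if it is `1` at the boundary
point `1`. -/
theorem IsDiscFactorization.map_coeffConj_eq {T N : Matrix ι κ (RatFunc ℂ)}
    {D X : Matrix κ κ (RatFunc ℂ)} {Y : Matrix κ ι (RatFunc ℂ)} (h : IsDiscFactorization T N D X Y)
    (hT : T.map coeffConj = T) (h1 : MatrixTakesValue D ((1 : ℂ) : OnePoint ℂ) 1) :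
    D.map coeffConj = D := by
  have hinner := mul_eq_one_comm.1 h.inner
  set D' := D.map coeffConj with hD'
  set N' := N.map coeffConj with hN'
  have hTD : T * D' = N' := by
    rw [hN', ← h.mul_denom, Matrix.map_mul, hT]
  have hinner' : D' * paraConjTranspose .discrete D' = 1 := by
    rw [hD', paraConjTranspose_coeffConj, ← Matrix.map_mul, hinner,
      Matrix.map_one _ (map_zero _) (map_one _)]
  have hbez' : X.map coeffConj * D' + Y.map coeffConj * N' = 1 := by
    rw [hD', hN', ← Matrix.map_mul, ← Matrix.map_mul,
      ← Matrix.map_add _ (map_add _), h.bezout, Matrix.map_one _ (map_zero _) (map_one _)]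
  -- `U = D⁻¹ D'` compares two inner denominators of the same `T`. The two Bezout identities make
  -- `U` and `U^*` stable, so `U` is constant; its value at the real point `1` is the identity.
  set U := paraConjTranspose .discrete D * D' with hU
  have hDU : D * U = D' := by
    rw [hU, ← Matrix.mul_assoc, hinner, Matrix.one_mul]
  have hU' : paraConjTranspose .discrete U = paraConjTranspose .discrete D' * D := by
    rw [hU, paraConjTranspose_mul, paraConjTranspose_paraConjTranspose]
  have hDU' : D' * paraConjTranspose .discrete U = D := by
    rw [hU', ← Matrix.mul_assoc, hinner', Matrix.one_mul]
  have hUst : IsDiscStable U := by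
    have e : U = X * D' + Y * N' := by
      calc U = (X * D + Y * N) * U := by rw [h.bezout, Matrix.one_mul]
        _ = X * (D * U) + Y * (T * (D * U)) := by
          rw [← h.mul_denom, Matrix.add_mul]
          simp only [Matrix.mul_assoc]
        _ = X * D' + Y * N' := by rw [hDU, hTD]
    rw [e]
    exact (h.stable_left.mul h.stable_denom.coeffConj).add
      (h.stable_right.mul h.stable_num.coeffConj)
  have hUst' : IsDiscStable (paraConjTranspose .discrete U) := by
    have e : paraConjTranspose .discrete U = X.map coeffConj * D + Y.map coeffConj * N := by
      calc paraConjTranspose .discrete U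
          = (X.map coeffConj * D' + Y.map coeffConj * N') * paraConjTranspose .discrete U := by
            rw [hbez', Matrix.one_mul]
        _ = X.map coeffConj * (D' * paraConjTranspose .discrete U) +
            Y.map coeffConj * (T * (D' * paraConjTranspose .discrete U)) := by
          rw [← hTD, Matrix.add_mul]
          simp only [Matrix.mul_assoc]
        _ = X.map coeffConj * D + Y.map coeffConj * N := by rw [hDU', h.mul_denom]
    rw [e]
    exact (h.stable_left.coeffConj.mul h.stable_denom).add
      (h.stable_right.coeffConj.mul h.stable_num)
  have hconst : ∀ i j, ∃ c, U i j = RatFunc.C c := fun i j =>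
    exists_eq_C_of_mem_discRing (hUst i j) (by
      have := hUst' j i
      rwa [paraConjTranspose_apply] at this)
  choose u hu using hconst
  have hD'1 : MatrixTakesValue D' ((1 : ℂ) : OnePoint ℂ) 1 := by
    intro i j
    have h0 : starRingEnd ℂ ((1 : Matrix κ κ ℂ) i j) = (1 : Matrix κ κ ℂ) i j := by
      by_cases hij : i = j
      · subst hij
        simp
      · simp [hij]
    have := (h1 i j).coeffConj
    rw [map_one, h0] at this
    exact this
  have hU1 : MatrixTakesValue U ((1 : ℂ) : OnePoint ℂ) 1 := by
    have := (h1.paraConjTranspose (τ := .discrete) ⟨1, rfl, by simp⟩).mul hD'1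
    simpa using this
  have hUone : U = 1 := by
    have hu' : MatrixTakesValue U ((1 : ℂ) : OnePoint ℂ) (Matrix.of u) := by
      intro i j
      rw [hu]
      exact takesValue_C _ _
    have e := hu'.unique hU1
    ext i j
    have : u i j = (1 : Matrix κ κ ℂ) i j := congrFun (congrFun e i) j
    rw [hu, this]
    by_cases hij : i = j
    · subst hij
      simp
    · simp [hij]
  rw [← hDU, hUone, Matrix.mul_one]

/-- A factorization with inner denominator can be multiplied by a constant unitary matrix. -/
theorem IsDiscFactorization.mul_unitary {T N : Matrix ι κ (RatFunc ℂ)}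
    {D X : Matrix κ κ (RatFunc ℂ)} {Y : Matrix κ ι (RatFunc ℂ)} (h : IsDiscFactorization T N D X Y)
    {E : Matrix κ κ ℂ} (hE : E.conjTranspose * E = 1) :
    IsDiscFactorization T (N * E.map RatFunc.C) (D * E.map RatFunc.C)
      (E.conjTranspose.map RatFunc.C * X) (E.conjTranspose.map RatFunc.C * Y) where
  stable_num := h.stable_num.mul (isDiscStable_map_C E)
  stable_denom := h.stable_denom.mul (isDiscStable_map_C E)
  stable_left := (isDiscStable_map_C _).mul h.stable_left
  stable_right := (isDiscStable_map_C _).mul h.stable_right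
  mul_denom := by rw [← Matrix.mul_assoc, h.mul_denom]
  inner := by
    rw [paraConjTranspose_mul, paraConjTranspose_map_C, Matrix.mul_assoc, ← Matrix.mul_assoc _ D,
      h.inner, Matrix.one_mul, ← Matrix.map_mul, hE, Matrix.map_one _ (map_zero _) (map_one _)]
  bezout := by
    have e : E.conjTranspose.map RatFunc.C * X * (D * E.map RatFunc.C) +
        E.conjTranspose.map RatFunc.C * Y * (N * E.map RatFunc.C) =
        E.conjTranspose.map RatFunc.C * (X * D + Y * N) * E.map RatFunc.C := by
      simp only [Matrix.mul_add, Matrix.add_mul, Matrix.mul_assoc]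
    rw [e, h.bezout, Matrix.mul_one, ← Matrix.map_mul, hE,
      Matrix.map_one _ (map_zero _) (map_one _)]

/-- An inner denominator has a unitary value `A` at the boundary point `1`; multiplying by `A^*`
normalizes this value to the identity. -/
theorem exists_real_isDiscFactorization {T : Matrix ι κ (RatFunc ℂ)}
    (hT : ∀ w : ℂ, ‖w‖ = 1 → ∃ A, MatrixTakesValue T w A) (hreal : T.map coeffConj = T) :
    ∃ N D X Y, IsDiscFactorization T N D X Y ∧ N.map coeffConj = N ∧ D.map coeffConj = D := by
  obtain ⟨N, D, X, Y, h⟩ := exists_isDiscFactorization T hT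
  obtain ⟨A, hA⟩ := h.stable_denom.exists_value (w := 1) (by simp)
  have hAA : A.conjTranspose * A = 1 := by
    have h1 := (hA.paraConjTranspose (τ := .discrete) ⟨1, rfl, by simp⟩).mul hA
    rw [h.inner] at h1
    exact h1.unique (matrixTakesValue_one _)
  have hAA' : A * A.conjTranspose = 1 := mul_eq_one_comm.1 hAA
  have h' := h.mul_unitary (E := A.conjTranspose) (by rwa [Matrix.conjTranspose_conjTranspose])
  have hD := h'.map_coeffConj_eq hreal (by
    have := hA.mul (matrixTakesValue_map_C A.conjTranspose _)
    rwa [hAA'] at this)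
  refine ⟨_, _, _, _, h', ?_, hD⟩
  rw [← h'.mul_denom, Matrix.map_mul, hreal, hD]

/-! ### Transport to the two time domains -/

theorem isStable_iff {ι κ : Type*} {τ : TimeDomain} {W : Matrix ι κ (RatFunc ℂ)} :
    IsStable τ W ↔ ∀ α ∉ τ.stableRegion, ∃ A, MatrixTakesValue W α A := by
  constructor
  · exact fun h α hα => ⟨_, matrixTakesValue_of_not_isPoleOf fun hp => hα (h α hp)⟩
  · intro h α hp
    by_contra hα
    obtain ⟨A, hA⟩ := h α hα
    exact hA.not_isPoleOf hp

theorem IsDiscStable.isStable_chart {ι κ : Type*} {W : Matrix ι κ (RatFunc ℂ)}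
    (h : IsDiscStable W) (τ : TimeDomain) : IsStable τ (W.map (chart τ)) := by
  rw [isStable_iff]
  intro α hα
  obtain ⟨w, hw, rfl⟩ := exists_point_of_notMem_stableRegion hα
  obtain ⟨A, hA⟩ := h.exists_value hw
  exact ⟨A, fun i j => (hA i j).chart τ⟩

theorem paraConjTranspose_chart {ι κ : Type*} (τ : TimeDomain) (W : Matrix ι κ (RatFunc ℂ)) :
    paraConjTranspose τ (W.map (chart τ)) = (paraConjTranspose .discrete W).map (chart τ) := by
  ext i j
  simp [paraConjTranspose_apply, paraConjHom_chart]

theorem det_ne_zero_of_inner {τ : TimeDomain} {Q : Matrix κ κ (RatFunc ℂ)}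
    (hQ : paraConjTranspose τ Q * Q = 1) : Q.det ≠ 0 := by
  intro h
  have := congrArg Matrix.det hQ
  rw [Matrix.det_mul, h, mul_zero, Matrix.det_one] at this
  exact zero_ne_one this

theorem IsDiscFactorization.chart {T N : Matrix ι κ (RatFunc ℂ)} {D X : Matrix κ κ (RatFunc ℂ)}
    {Y : Matrix κ ι (RatFunc ℂ)} (h : IsDiscFactorization T N D X Y) (τ : TimeDomain) :
    IsRightCoprimeFactorization τ (T.map (chart τ)) (N.map (chart τ)) (D.map (chart τ)) ∧
      IsInner τ (D.map (chart τ)) := by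
  have hinner : paraConjTranspose τ (D.map (SpecFact.chart τ)) * D.map (SpecFact.chart τ) = 1 := by
    rw [paraConjTranspose_chart, ← Matrix.map_mul, h.inner,
      Matrix.map_one _ (map_zero _) (map_one _)]
  have hdet := det_ne_zero_of_inner hinner
  refine ⟨⟨h.stable_num.isStable_chart τ, h.stable_denom.isStable_chart τ, hdet, ?_, ?_⟩,
    h.stable_denom.isStable_chart τ, hinner⟩
  · rw [← h.mul_denom, Matrix.map_mul, Matrix.mul_nonsing_inv_cancel_right _ _ hdet.isUnit]
  · refine ⟨_, _, h.stable_left.isStable_chart τ, h.stable_right.isStable_chart τ, ?_⟩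
    rw [← Matrix.map_mul, ← Matrix.map_mul, ← Matrix.map_add _ (map_add _), h.bezout,
      Matrix.map_one _ (map_zero _) (map_one _)]

theorem exists_map_chart_eq {ι κ : Type*} (τ : TimeDomain) (T : Matrix ι κ (RatFunc ℂ)) :
    ∃ T' : Matrix ι κ (RatFunc ℂ), T'.map (chart τ) = T := by
  choose f hf using chart_surjective τ
  exact ⟨T.map f, by ext i j; simp [hf]⟩

theorem exists_value_of_map_chart {ι κ : Type*} {τ : TimeDomain} {T : Matrix ι κ (RatFunc ℂ)}
    (hT : ∀ α ∈ τ.boundary, ∃ A, MatrixTakesValue (T.map (chart τ)) α A) (w : ℂ) (hw : ‖w‖ = 1) :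
    ∃ A, MatrixTakesValue T w A := by
  obtain ⟨A, hA⟩ := hT _ (point_mem_boundary τ hw)
  exact ⟨A, fun i j => takesValue_of_chart (hA i j)⟩

/-- A rational matrix without poles on the boundary has a right-coprime factorization with inner
denominator. -/
theorem exists_isRightCoprimeFactorization {τ : TimeDomain} {T : Matrix ι κ (RatFunc ℂ)}
    (hT : ∀ α ∈ τ.boundary, ∃ A, MatrixTakesValue T α A) :
    ∃ N D, IsRightCoprimeFactorization τ T N D ∧ IsInner τ D := by
  obtain ⟨T, rfl⟩ := exists_map_chart_eq τ T
  obtain ⟨N, D, X, Y, h⟩ := exists_isDiscFactorization T (exists_value_of_map_chart hT)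
  exact ⟨_, _, h.chart τ⟩

theorem isRealMatrix_iff {ι κ : Type*} (W : Matrix ι κ (RatFunc ℂ)) :
    IsRealMatrix W ↔ W.map coeffConj = W := by
  simp [IsRealMatrix, isReal_iff, ← Matrix.ext_iff]

theorem map_coeffConj_map_chart {ι κ : Type*} (τ : TimeDomain) (W : Matrix ι κ (RatFunc ℂ)) :
    (W.map (chart τ)).map coeffConj = (W.map coeffConj).map (chart τ) := by
  ext i j
  simp [coeffConj_chart]

theorem exists_real_isRightCoprimeFactorization {τ : TimeDomain} {T : Matrix ι κ (RatFunc ℂ)}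
    (hT : ∀ α ∈ τ.boundary, ∃ A, MatrixTakesValue T α A) (hreal : IsRealMatrix T) :
    ∃ N D, IsRightCoprimeFactorization τ T N D ∧ IsInner τ D ∧ IsRealMatrix N ∧
      IsRealMatrix D := by
  obtain ⟨T, rfl⟩ := exists_map_chart_eq τ T
  rw [isRealMatrix_iff, map_coeffConj_map_chart] at hreal
  obtain ⟨N, D, X, Y, h, hN, hD⟩ := exists_real_isDiscFactorization (exists_value_of_map_chart hT)
    (Matrix.map_injective (chart_injective τ) hreal)
  refine ⟨_, _, (h.chart τ).1, (h.chart τ).2, ?_, ?_⟩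
  · rw [isRealMatrix_iff, map_coeffConj_map_chart, hN]
  · rw [isRealMatrix_iff, map_coeffConj_map_chart, hD]

/-! ### Spectral densities -/

/-- If `T * T^*` has no poles on the boundary, then neither has `T`. -/
theorem exists_value_of_mul_paraConjTranspose {ι κ : Type*} [Fintype κ] {τ : TimeDomain}
    {T : Matrix ι κ (RatFunc ℂ)} {α : OnePoint ℂ} (hα : α ∈ τ.boundary) {A : Matrix ι ι ℂ}
    (h : MatrixTakesValue (T * paraConjTranspose τ T) α A) : ∃ B, MatrixTakesValue T α B := by
  suffices key : ∀ i j, ∃ b, TakesValue (T i j) α b by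
    choose B hB using key
    exact ⟨B, hB⟩
  intro i
  by_contra hcon
  push Not at hcon
  obtain ⟨j₁, hj₁⟩ := hcon
  -- an entry of the row which dominates all the others at `α`
  obtain ⟨j₀, hj₀, hmax⟩ : ∃ j₀, (∀ b, ¬ TakesValue (T i j₀) α b) ∧
      ∀ j, ∃ c, TakesValue (T i j / T i j₀) α c := by
    have hne : ∀ j, (∀ b, ¬ TakesValue (T i j) α b) → T i j ≠ 0 := by
      intro j hj h0
      exact hj 0 (h0 ▸ takesValue_zero α)
    -- Any two entries are comparable in the valuation ring at `α`, so a finite maximum exists. The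
    -- maximum keeps its pole, since an entry dominated by an analytic one is analytic.
    have hfin : ∀ s : Finset κ, ∃ j₀, (∀ b, ¬ TakesValue (T i j₀) α b) ∧
        ∀ j ∈ s, ∃ c, TakesValue (T i j / T i j₀) α c := by
      classical
      intro s
      induction s using Finset.induction_on with
      | empty => exact ⟨j₁, hj₁, by simp⟩
      | insert k s _ ih =>
        obtain ⟨j₀, hj₀, hs⟩ := ih
        rcases exists_takesValue_or_inv (T i k / T i j₀) α with hk | hk
        · refine ⟨j₀, hj₀, fun j hj => ?_⟩
          rcases Finset.mem_insert.1 hj with rfl | hj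
          · exact hk
          · exact hs j hj
        · rw [inv_div] at hk
          by_cases hk0 : T i k = 0
          · refine ⟨j₀, hj₀, fun j hj => ?_⟩
            rcases Finset.mem_insert.1 hj with rfl | hj
            · exact ⟨0, by simpa [hk0] using takesValue_zero α⟩
            · exact hs j hj
          refine ⟨k, fun b hb => hj₀ (0 * b) ?_, fun j hj => ?_⟩
          · have := hk.mul hb
            rwa [div_mul_cancel₀ _ hk0] at this
          · rcases Finset.mem_insert.1 hj with rfl | hj
            · exact ⟨1, by simpa [hk0] using takesValue_one α⟩
            · obtain ⟨c, hc⟩ := hs j hj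
              have := hc.mul hk
              rw [div_mul_div_cancel₀ (hne j₀ hj₀)] at this
              exact ⟨_, this⟩
    obtain ⟨j₀, h0, h1⟩ := hfin Finset.univ
    exact ⟨j₀, h0, fun j => h1 j (Finset.mem_univ j)⟩
  have hT0 : T i j₀ ≠ 0 := fun h0 => hj₀ 0 (h0 ▸ takesValue_zero α)
  have hinv : TakesValue (T i j₀)⁻¹ α 0 := by
    rcases exists_takesValue_or_inv (T i j₀) α with ⟨b, hb⟩ | h0
    · exact absurd hb (hj₀ b)
    · exact h0
  choose c hc using hmax
  have hc0 : c j₀ = 1 := by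
    have := hc j₀
    rw [div_self hT0] at this
    exact this.unique (takesValue_one α)
  -- The diagonal entry of `T T^*` divided by `T i j₀ * (T i j₀)^*` has value `0` at `α`. It is also
  -- the sum of all `|c j|²`, contradicting `c j₀ = 1`.
  have hsum := TakesValue.sum (s := Finset.univ) fun j _ => (hc j).mul ((hc j).paraConjHom hα)
  have hprod := (h i i).mul (hinv.mul (hinv.paraConjHom hα))
  have e : ∑ j, T i j / T i j₀ * paraConjHom τ (T i j / T i j₀) =
      (T * paraConjTranspose τ T) i i * ((T i j₀)⁻¹ * paraConjHom τ (T i j₀)⁻¹) := by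
    rw [Matrix.mul_apply, Finset.sum_mul]
    refine Finset.sum_congr rfl fun j _ => ?_
    rw [paraConjTranspose_apply, map_div₀, map_inv₀]
    ring
  rw [← e] at hprod
  have h0 := hsum.unique hprod
  simp only [Complex.mul_conj, zero_mul, mul_zero] at h0
  rw [← Complex.ofReal_sum, Complex.ofReal_eq_zero,
    Finset.sum_eq_zero_iff_of_nonneg fun j _ => Complex.normSq_nonneg _] at h0
  have := h0 j₀ (Finset.mem_univ _)
  simp [hc0] at this

theorem infinite_boundary (τ : TimeDomain) : {z : ℂ | (z : OnePoint ℂ) ∈ τ.boundary}.Infinite := by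
  cases τ with
  | discrete =>
    have h : Set.Infinite (Metric.sphere (0 : ℂ) 1) := by
      refine (isPreconnected_sphere (by simp [Complex.rank_real_complex]) 0 1).infinite_of_nontrivial
        ⟨1, by simp, -1, by simp, ?_⟩
      norm_num [Complex.ext_iff]
    exact h.mono fun z hz => ⟨z, rfl, by simpa using hz⟩
  | continuous =>
    refine (Set.infinite_range_of_injective (f := fun x : ℝ => (x : ℂ) * Complex.I) ?_).mono ?_
    · intro x y hxy
      simpa using hxy
    · rintro _ ⟨x, rfl⟩
      exact Or.inr ⟨_, rfl, by simp⟩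

/-- A spectral density is para-Hermitian. -/
theorem IsSpectralDensity.paraConjTranspose_eq {ι : Type*} [Fintype ι] {τ : TimeDomain}
    {Φ : Matrix ι ι (RatFunc ℂ)} (h : IsSpectralDensity τ Φ) : paraConjTranspose τ Φ = Φ := by
  ext i j
  rw [← sub_eq_zero]
  -- At finite boundary points `Φ^*` takes the adjoint of the value of `Φ`, and that value is
  -- Hermitian.
  refine eq_zero_of_infinite (infinite_boundary τ) fun z hz => ?_
  have h1 := matrixTakesValue_of_not_isPoleOf (h _ hz).1
  have h2 := h1.paraConjTranspose hz
  rw [(h _ hz).2.isHermitian.eq] at h2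
  simpa using (h2 i j).sub (h1 i j)

/-! ### Rank and Schur complements over a field -/

theorem isUnit_det_of_rank_eq {K m : Type*} [Field K] [Fintype m] [DecidableEq m]
    {A : Matrix m m K} (h : A.rank = Fintype.card m) : IsUnit A.det := by
  rw [← Matrix.isUnit_iff_isUnit_det, ← Matrix.mulVec_surjective_iff_isUnit]
  have : LinearMap.range A.mulVecLin = ⊤ :=
    Submodule.eq_top_of_finrank_eq (by rw [Module.finrank_fintype_fun_eq_card]; exact h)
  exact LinearMap.range_eq_top.1 this

theorem rank_fromRows_of_isUnit_det {K m p : Type*} [Field K] [Fintype m] [Fintype p]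
    [DecidableEq m] {A : Matrix m m K} (hA : IsUnit A.det) (B : Matrix p m K) :
    (Matrix.fromRows A B).rank = Fintype.card m := by
  refine le_antisymm (Matrix.rank_le_card_width _) ?_
  have h : A = Matrix.fromCols (1 : Matrix m m K) (0 : Matrix m p K) * Matrix.fromRows A B := by
    rw [Matrix.fromCols_mul_fromRows, Matrix.one_mul, Matrix.zero_mul, add_zero]
  calc Fintype.card m = A.rank :=
        (Matrix.rank_of_isUnit A ((Matrix.isUnit_iff_isUnit_det A).2 hA)).symm
    _ ≤ (Matrix.fromRows A B).rank := by
      conv_lhs => rw [h]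
      exact Matrix.rank_mul_le_right _ _

/-- The Schur complement of a block of full rank vanishes. -/
theorem toBlocks₂₂_eq_of_rank {K m p : Type*} [Field K] [Fintype m] [Fintype p]
    [DecidableEq m] [DecidableEq p] (Φ : Matrix (m ⊕ p) (m ⊕ p) K)
    (hrank : Φ.rank = Fintype.card m) (hdet : IsUnit Φ.toBlocks₁₁.det) :
    Φ.toBlocks₂₂ = Φ.toBlocks₂₁ * Φ.toBlocks₁₁⁻¹ * Φ.toBlocks₁₂ := by
  -- The first block column `L` already has the rank of `Φ`, so it spans the column space. The
  -- second block column is then `L` times a matrix, which the upper block determines.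
  set L := Matrix.fromRows Φ.toBlocks₁₁ Φ.toBlocks₂₁ with hL
  have hLΦ : L = Φ * Matrix.fromRows (1 : Matrix m m K) (0 : Matrix p m K) := by
    conv_rhs => rw [← Matrix.fromBlocks_toBlocks Φ, Matrix.fromBlocks_mul_fromRows]
    simp [hL]
  have hle : LinearMap.range L.mulVecLin ≤ LinearMap.range Φ.mulVecLin := by
    rw [hLΦ, Matrix.mulVecLin_mul]
    exact LinearMap.range_comp_le_range _ _
  have heq : LinearMap.range L.mulVecLin = LinearMap.range Φ.mulVecLin := by
    refine Submodule.eq_of_le_of_finrank_eq hle ?_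
    exact (rank_fromRows_of_isUnit_det hdet _).trans hrank.symm
  have hcol : ∀ j, ∃ y, L.mulVec y = Φ.col (Sum.inr j) := by
    intro j
    have h : Φ.mulVecLin (Pi.single (Sum.inr j) 1) ∈ LinearMap.range Φ.mulVecLin := ⟨_, rfl⟩
    rw [← heq] at h
    obtain ⟨y, hy⟩ := h
    exact ⟨y, by simpa using hy⟩
  choose y hy using hcol
  have h12 : Φ.toBlocks₁₂ = Φ.toBlocks₁₁ * (Matrix.of y).transpose := by
    ext i j
    exact (congrFun (hy j) (Sum.inl i)).symm
  have h22 : Φ.toBlocks₂₂ = Φ.toBlocks₂₁ * (Matrix.of y).transpose := by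
    ext i j
    exact (congrFun (hy j) (Sum.inr i)).symm
  rw [h22, h12, Matrix.mul_assoc, Matrix.nonsing_inv_mul_cancel_left _ _ hdet]

end Matrices

end SpecFact

end

/-! ### Assembly of the spectral factor -/

theorem lemma3p1 (τ : SpecFact.TimeDomain) (m p : ℕ) (hm : 0 < m)
    (Φ : Matrix (Fin m ⊕ Fin p) (Fin m ⊕ Fin p) (RatFunc ℂ))
    (hΦ : SpecFact.IsSpectralDensity τ Φ) (hrank : Φ.rank = m)
    (hrank₁₁ : Φ.toBlocks₁₁.rank = m)
    (H : Matrix (Fin p) (Fin m) (RatFunc ℂ))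
    (hH : H = Φ.toBlocks₂₁ * (Φ.toBlocks₁₁)⁻¹)
    (G₁ : Matrix (Fin m) (Fin m) (RatFunc ℂ))
    (hG₁ : SpecFact.IsMinimumPhase τ G₁)
    (hG₁Φ : SpecFact.IsSpectralFactor τ Φ.toBlocks₁₁ G₁) :
    -- a right-coprime factorization of `H * G₁` with inner denominator exists,
    (∃ (W₂ : Matrix (Fin p) (Fin m) (RatFunc ℂ)) (Q₁ : Matrix (Fin m) (Fin m) (RatFunc ℂ)),
      SpecFact.IsRightCoprimeFactorization τ (H * G₁) W₂ Q₁ ∧ SpecFact.IsInner τ Q₁) ∧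
    -- with real coefficients if the data have real coefficients,
    (SpecFact.IsRealMatrix Φ → SpecFact.IsRealMatrix G₁ →
      ∃ (W₂ : Matrix (Fin p) (Fin m) (RatFunc ℂ)) (Q₁ : Matrix (Fin m) (Fin m) (RatFunc ℂ)),
        SpecFact.IsRightCoprimeFactorization τ (H * G₁) W₂ Q₁ ∧ SpecFact.IsInner τ Q₁ ∧
        SpecFact.IsRealMatrix W₂ ∧ SpecFact.IsRealMatrix Q₁) ∧
    -- and every such factorization gives a full-rank minimum-phase spectral factor of `Φ`.
    (∀ (W₂ : Matrix (Fin p) (Fin m) (RatFunc ℂ)) (Q₁ : Matrix (Fin m) (Fin m) (RatFunc ℂ)),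
      SpecFact.IsRightCoprimeFactorization τ (H * G₁) W₂ Q₁ → SpecFact.IsInner τ Q₁ →
        (G₁ * Q₁).rank = m ∧
        (Matrix.fromRows (G₁ * Q₁) W₂).rank = m ∧
        SpecFact.IsMinimumPhase τ (Matrix.fromRows (G₁ * Q₁) W₂) ∧
        SpecFact.IsSpectralFactor τ Φ (Matrix.fromRows (G₁ * Q₁) W₂)) := by
  open SpecFact in
  have hdet : IsUnit Φ.toBlocks₁₁.det := isUnit_det_of_rank_eq (by simpa using hrank₁₁)
  have hG₁Φ' : Φ.toBlocks₁₁ = G₁ * paraConjTranspose τ G₁ := hG₁Φ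
  have hG₁det : IsUnit G₁.det := by
    rw [hG₁Φ', Matrix.det_mul] at hdet
    exact isUnit_of_mul_isUnit_left hdet
  have hsym := hΦ.paraConjTranspose_eq
  have h12 : paraConjTranspose τ Φ.toBlocks₂₁ = Φ.toBlocks₁₂ := by
    ext i j
    exact congrFun (congrFun hsym (Sum.inl i)) (Sum.inr j)
  have hHΦ : H * Φ.toBlocks₁₁ = Φ.toBlocks₂₁ := by
    rw [hH, Matrix.nonsing_inv_mul_cancel_right _ _ hdet]
  have h11 : paraConjTranspose τ Φ.toBlocks₁₁ = Φ.toBlocks₁₁ := by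
    rw [hG₁Φ', paraConjTranspose_mul, paraConjTranspose_paraConjTranspose]
  have h12' : Φ.toBlocks₁₁ * paraConjTranspose τ H = Φ.toBlocks₁₂ := by
    rw [← h12, ← hHΦ, paraConjTranspose_mul, h11]
  -- The vanishing Schur complement gives `Φ₂₂ = H Φ₁₂`, and `Φ₁₂ = Φ₁₁ H^* = G₁ G₁^* H^*`.
  have hTT : H * G₁ * paraConjTranspose τ (H * G₁) = Φ.toBlocks₂₂ := by
    rw [toBlocks₂₂_eq_of_rank Φ (by simpa using hrank) hdet, paraConjTranspose_mul,
      Matrix.mul_assoc, ← Matrix.mul_assoc G₁, ← hG₁Φ', h12', hH]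
  have hT : ∀ α ∈ τ.boundary, ∃ A, MatrixTakesValue (H * G₁) α A := by
    intro α hα
    refine exists_value_of_mul_paraConjTranspose hα
      (A := (matrixValueAt Φ α).toBlocks₂₂) ?_
    rw [hTT]
    exact fun i j => matrixTakesValue_of_not_isPoleOf (hΦ α hα).1 _ _
  refine ⟨exists_isRightCoprimeFactorization hT, fun hΦr hGr =>
    exists_real_isRightCoprimeFactorization hT ?_, fun W₂ Q₁ hfac hQ => ?_⟩
  · rw [isRealMatrix_iff] at hΦr hGr ⊢
    have e11 : Φ.toBlocks₁₁.map coeffConj = Φ.toBlocks₁₁ := by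
      ext i j
      exact congrFun (congrFun hΦr _) _
    have e21 : Φ.toBlocks₂₁.map coeffConj = Φ.toBlocks₂₁ := by
      ext i j
      exact congrFun (congrFun hΦr _) _
    -- Reality of `H` follows by cancelling `Φ₁₁` in `H Φ₁₁ = Φ₂₁`, so no inverse has to be
    -- conjugated.
    have eH : H.map coeffConj * Φ.toBlocks₁₁ = H * Φ.toBlocks₁₁ := by
      conv_lhs => rw [← e11]
      rw [← Matrix.map_mul, hHΦ, e21]
    have eH' : H.map coeffConj = H := by
      have := congrArg (· * Φ.toBlocks₁₁⁻¹) eH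
      simpa only [Matrix.mul_nonsing_inv_cancel_right _ _ hdet] using this
    rw [Matrix.map_mul, eH', hGr]
  · have hQ' : Q₁ * paraConjTranspose τ Q₁ = 1 := mul_eq_one_comm.1 hQ.2
    have hQdet : IsUnit Q₁.det := hfac.det_ne_zero.isUnit
    have hW₁det : IsUnit (G₁ * Q₁).det := by
      rw [Matrix.det_mul]
      exact hG₁det.mul hQdet
    have hW₂ : W₂ = H * G₁ * Q₁ := by
      rw [hfac.eq_mul_inv, Matrix.nonsing_inv_mul_cancel_right _ _ hQdet]
    have hval : ∀ α ∉ τ.stableRegion, ∃ A B C, MatrixTakesValue G₁ α A ∧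
        MatrixTakesValue Q₁ α B ∧ MatrixTakesValue W₂ α C := fun α hα =>
      let ⟨A, hA⟩ := isStable_iff.1 hG₁.1 α hα
      let ⟨B, hB⟩ := isStable_iff.1 hQ.1 α hα
      let ⟨C, hC⟩ := isStable_iff.1 hfac.stable_num α hα
      ⟨A, B, C, hA, hB, hC⟩
    have hrows : ∀ {α A B C}, MatrixTakesValue G₁ α A → MatrixTakesValue Q₁ α B →
        MatrixTakesValue W₂ α C →
        MatrixTakesValue (Matrix.fromRows (G₁ * Q₁) W₂) α (Matrix.fromRows (A * B) C) := by
      intro α A B C hA hB hC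
      rintro (i | i) j
      · exact hA.mul hB i j
      · exact hC i j
    refine ⟨?_, ?_, ⟨?_, ?_⟩, ?_⟩
    · simpa using Matrix.rank_of_isUnit _ ((Matrix.isUnit_iff_isUnit_det _).2 hW₁det)
    · simpa using rank_fromRows_of_isUnit_det hW₁det W₂
    · rw [isStable_iff]
      intro α hα
      obtain ⟨A, B, C, hA, hB, hC⟩ := hval α hα
      exact ⟨_, hrows hA hB hC⟩
    · rintro α ⟨hpole, v, hv0, hv⟩
      by_contra hα
      have hα' : α ∉ τ.stableRegion := fun h => hα (Or.inl h)
      obtain ⟨A, B, C, hA, hB, hC⟩ := hval α hα'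
      rw [(matrixTakesValue_of_not_isPoleOf hpole).unique (hrows hA hB hC),
        Matrix.fromRows_mulVec] at hv
      have hABv : (A * B).mulVec v = 0 := funext fun i => congrFun hv (Sum.inl i)
      have hCv : C.mulVec v = 0 := funext fun i => congrFun hv (Sum.inr i)
      -- Otherwise `B v` would be a zero direction of `G₁` at `α`, outside the closed stability
      -- region.
      have hBv : B.mulVec v = 0 := by
        by_contra hBv
        refine hα (hG₁.2 α ⟨hA.not_isPoleOf, _, hBv, ?_⟩)
        rw [(matrixTakesValue_of_not_isPoleOf hA.not_isPoleOf).unique hA, Matrix.mulVec_mulVec,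
          hABv]
      obtain ⟨X, Y, hX, hY, hXY⟩ := hfac.bezout
      obtain ⟨X', hX'⟩ := isStable_iff.1 hX α hα'
      obtain ⟨Y', hY'⟩ := isStable_iff.1 hY α hα'
      -- At `α` the Bezout identity reads `X' B + Y' C = 1`; applied to `v`, its left side vanishes.
      have h1 := (hX'.mul hB).add (hY'.mul hC)
      rw [hXY] at h1
      have h2 := congrArg (fun M => M.mulVec v) (h1.unique (matrixTakesValue_one α))
      simp only [Matrix.add_mulVec, ← Matrix.mulVec_mulVec, hBv, hCv, Matrix.mulVec_zero,
        Matrix.one_mulVec, add_zero] at h2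
      exact hv0 h2.symm
    · have hW₁W₁ : G₁ * Q₁ * paraConjTranspose τ (G₁ * Q₁) = Φ.toBlocks₁₁ := by
        rw [paraConjTranspose_mul, Matrix.mul_assoc, ← Matrix.mul_assoc Q₁, hQ', Matrix.one_mul,
          hG₁Φ']
      have hW₂' : W₂ = H * (G₁ * Q₁) := by rw [hW₂, Matrix.mul_assoc]
      have e : paraConjTranspose τ (Matrix.fromRows (G₁ * Q₁) W₂) =
          Matrix.fromCols (paraConjTranspose τ (G₁ * Q₁)) (paraConjTranspose τ W₂) := by
        ext i (j | j) <;> rfl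
      have h22 : H * Φ.toBlocks₁₂ = Φ.toBlocks₂₂ := by
        rw [← hTT, paraConjTranspose_mul, Matrix.mul_assoc, ← Matrix.mul_assoc G₁, ← hG₁Φ',
          h12']
      rw [IsSpectralFactor, e, Matrix.fromRows_mul_fromCols, hW₂', paraConjTranspose_mul τ H,
        ← Matrix.mul_assoc, Matrix.mul_assoc H, Matrix.mul_assoc H, ← Matrix.mul_assoc (G₁ * Q₁),
        hW₁W₁, h12', hHΦ]
      conv_lhs => rw [← Matrix.fromBlocks_toBlocks Φ]
      rw [h22]
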